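/- **Setting.** A warehouse is a rectilinear grid in $[0,L]\times[0,W]$ ($L,W>0$) made of $a\ge 1$ equidistant parallel aisles of length $W$ and $b\ge 2$ equidistant cross-aisles of length $L$, with a depot $l_d$ at a point of the grid; $d$ is the shortest-path distance within the grid. A picker walks at unit speed, starts at $l_d$ at time $0$, and picks items in zero time. An instance $I$ consists of orders $o_1,\dots,o_n$ with arrival times $0\le r_1\le\dots\le r_n$; each order is a set of $k\ge1$ distinct picking locations (items) in the aisles. Orders are collected in batches of at most $c\ge1$ orders, one batch after the other, and no order is split between batches. With a *pushcart* the picker returns to the depot at the end of each batch, and the total completion time is the time of the last return; with a *robot* she starts the next batch from where she is, and the total completion time is the time of the last pick. $CIOPT(I)$ is the minimum total completion time over all partitions into batches, sequences of the batches and sequences of the items in each batch, where no item is picked before the arrival of its order, but all data are known in advance. $Reopt(I)$ is the total completion time of the following online policy, with arbitrary choices among optimal plans and among shortest paths. *Non-interventionist* (system *Pcart-N*, pushcart): whenever the picker is at the depot and new orders have arrived, she plans anew, optimally, for all orders that have arrived and have not been picked; otherwise she continues with the next batch of the current plan, or, if there is none, waits at the depot. *Interventionist* (systems *Pcart* with a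 pushcart and *Robot* with a robot): she waits at the depot for the first order; at each arrival she plans anew, optimally and from her current position, for everything that has arrived and has not been picked, where orders with an item already in the current cart must be completed in the current batch, and the other bins of the cart can be assigned freely to orders not yet commenced; she follows the plan until the next arrival and, when it is completed, waits where she is. For $\lambda>0$ let, under $\mathbb P_\lambda$, the interarrival times of orders be i.i.d. exponential with mean $1/\lambda$, and the orders $O_1,O_2,\dots$ be i.i.d. with a fixed law (arbitrary dependence within an order) and independent of the arrival times. For *Robot* assume in addition $\mathbb E[K_1]>1$, where $K_1$ is the number of picking locations of $O_1$. For fixed $t>0$ let $I(t)^{rand}$ be the instance of all orders that arrive in $[0,t]$ (for an instance without orders the ratio $Reopt/CIOPT$ is set to $1$). **Theorem.** Let $(\lambda_i)_{i\in\mathbb N}$ be an increasing sequence of positive rates with $\lambda_i\to\infty$. In each of *Pcart-N*, *Pcart* and *Robot*, $$\lim_{i\to\infty}\mathbb E_{\lambda_i}\!\left[\frac{Reopt(I(t)^{rand})}{CIOPT(I(t)^{rand})}\right]=1,$$ and for every $\varepsilon>0$ $$\lim_{i\to\infty}\mathbb P_{\lambda_i}\!\left(\frac{Reopt(I(t)^{rand})}{CIOPT(I(t)^{rand})}\ge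 1+\varepsilon\right)=0 .$$ -/

import Mathlib

open MeasureTheory ProbabilityTheory Filter Topology
open scoped ENNReal

noncomputable section

namespace OOBSRP

/-! ### The warehouse -/

/-- Infrastructure parameters: length `L` (extent of the cross-aisles), width `W` (extent of the
aisles), `a ≥ 1` equidistant parallel aisles, `b ≥ 2` equidistant cross-aisles, the depot (a point
of the grid) and the batching capacity `c ≥ 1`. -/
structure Warehouse where
  L : ℝ
  W : ℝ
  a : ℕ
  b : ℕ
  c : ℕ
  L_pos : 0 < L
  W_pos : 0 < W
  one_le_a : 1 ≤ a
  two_le_b : 2 ≤ b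
  one_le_c : 1 ≤ c
  depotLoc : ℝ × ℝ
  depot_mem : depotLoc.1 ∈ Set.Icc 0 L ∧ depotLoc.2 ∈ Set.Icc 0 W ∧
    ((∃ i : ℕ, i < a ∧ depotLoc.1 = i * (L / ((a : ℝ) - 1))) ∨
      (∃ j : ℕ, j < b ∧ depotLoc.2 = j * (W / ((b : ℝ) - 1))))

namespace Warehouse

variable (w : Warehouse)

/-- `p` lies on one of the `a` aisles, at horizontal positions `0, L/(a-1), …, L`
(a single aisle is at position `0`). -/
def OnAisle (p : ℝ × ℝ) : Prop :=
  p.1 ∈ Set.Icc 0 w.L ∧ p.2 ∈ Set.Icc 0 w.W ∧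
    ∃ i : ℕ, i < w.a ∧ p.1 = i * (w.L / ((w.a : ℝ) - 1))

/-- `p` lies on one of the `b` cross-aisles, at vertical positions `0, W/(b-1), …, W`. -/
def OnCrossAisle (p : ℝ × ℝ) : Prop :=
  p.1 ∈ Set.Icc 0 w.L ∧ p.2 ∈ Set.Icc 0 w.W ∧
    ∃ j : ℕ, j < w.b ∧ p.2 = j * (w.W / ((w.b : ℝ) - 1))

/-- The region in which the picker can walk. -/
def grid : Set (ℝ × ℝ) := {p | w.OnAisle p ∨ w.OnCrossAisle p}

/-- Positions of the picker. -/
abbrev Pt : Type := {p : ℝ × ℝ // p ∈ w.grid}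

def depot : w.Pt :=
  ⟨w.depotLoc, by
    obtain ⟨h1, h2, h | h⟩ := w.depot_mem
    · exact Or.inl ⟨h1, h2, h⟩
    · exact Or.inr ⟨h1, h2, h⟩⟩

/-- `GridPath p q ℓ`: there is a polygonal path inside the grid from `p` to `q` of length `ℓ`
(every segment inside the grid is axis-parallel). -/
inductive GridPath : w.Pt → w.Pt → ℝ → Prop
  | refl (p : w.Pt) : GridPath p p 0
  | step {p q : w.Pt} {l : ℝ} (r : w.Pt) (h : GridPath p q l)
      (hseg : segment ℝ q.1 r.1 ⊆ w.grid) :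
      GridPath p r (l + (|q.1.1 - r.1.1| + |q.1.2 - r.1.2|))

/-- Walking distance (equivalently, walking time at unit speed) within the grid. -/
def d (p q : w.Pt) : ℝ := sInf {l | w.GridPath p q l}

/-- A customer order: a number `k ≥ 1` together with `k` distinct picking locations, all of them
in aisles. -/
abbrev CustomerOrder : Type :=
  {o : (Σ k : ℕ, (Fin k → w.Pt)) //
    1 ≤ o.1 ∧ Function.Injective o.2 ∧ ∀ i, w.OnAisle (o.2 i).1}

end Warehouse

/-- The number of picking locations of an order. -/
def Warehouse.CustomerOrder.size {w : Warehouse} (o : w.CustomerOrder) : ℕ := o.1.1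

/-- The three picking systems: pushcart with non-interventionist reoptimization, pushcart with
interventionist reoptimization, robot with interventionist reoptimization. -/
inductive PickingSystem
  | pcartN
  | pcart
  | robot

/-! ### Instances, plans and the complete-information optimum -/

/-- `n` orders with their arrival times (meant to be nonnegative and nondecreasing). -/
structure Instance (w : Warehouse) where
  n : ℕ
  order : Fin n → w.CustomerOrder
  arrival : Fin n → ℝ

variable {w : Warehouse}

namespace Instance

variable (I : Instance w)

/-- The items of an instance: `⟨j, i⟩` is the `i`-th item of order `j`. -/
abbrev Item : Type := Σ j : Fin I.n, Fin (I.order j).1.1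

def loc (x : I.Item) : w.Pt := (I.order x.1).1.2 x.2

/-- A plan: the sequence of batches, each given by the sequence in which its items are picked. -/
abbrev Plan : Type := List (List I.Item)

/-- The situation of the picker: her position, the items picked so far, and the orders that occupy
bins of the current cart (i.e. that have an item picked in the current, not yet finished batch). -/
structure State where
  pos : w.Pt
  picked : Finset I.Item
  cart : Finset (Fin I.n)

/-- At the depot, with nothing picked. -/
def init : I.State := ⟨w.depot, ∅, ∅⟩

/-- The orders that have arrived up to time `τ`. -/
def arrived (τ : ℝ) : Finset (Fin I.n) := Finset.univ.filter fun j => I.arrival j ≤ τ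

/-- The set of orders of a batch. -/
def ordersOf (B : List I.Item) : Finset (Fin I.n) := (B.map Sigma.fst).toFinset

/-- `P` is a feasible plan for collecting what remains of the orders in `A` from state `s`.
If the cart holds commenced orders, then the first batch of `P` is the continuation of the current
batch (possibly without further items). -/
structure Feasible (s : I.State) (A : Finset (Fin I.n)) (P : I.Plan) : Prop where
  /-- every remaining item is picked, exactly once -/
  nodup : P.flatten.Nodup
  complete : ∀ x : I.Item, x ∈ P.flatten ↔ x.1 ∈ A ∧ x ∉ s.picked
  /-- orders are not split between batches -/
  unsplit : ∀ B ∈ P, ∀ x ∈ B, ∀ y ∈ P.flatten, y.1 = x.1 → y ∈ B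
  /-- commenced orders are completed in the current batch -/
  commenced : ∀ x ∈ P.flatten, x.1 ∈ s.cart → x ∈ P.headD []
  continues : s.cart.Nonempty → P ≠ []
  /-- a batch contains at most `c` orders, including those already in the cart -/
  capacity_head : (s.cart ∪ I.ordersOf (P.headD [])).card ≤ w.c
  capacity_tail : ∀ B ∈ P.tail, (I.ordersOf B).card ≤ w.c
  /-- there are no void batches -/
  nonempty_head : s.cart = ∅ → ∀ B ∈ P, B ≠ []
  nonempty_tail : ∀ B ∈ P.tail, B ≠ []

/-- The elementary tasks of the picker: pick an item, or conclude the batch. -/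
inductive Action
  | pick (x : I.Item)
  | unload

/-- The actions of a batch: its picks, then its conclusion. -/
def batchActions (B : List I.Item) : List I.Action := B.map Action.pick ++ [Action.unload]

def actions (P : I.Plan) : List I.Action := P.flatMap I.batchActions

variable {I}

/-- The position to which an action takes the picker from `p`: a pushcart is brought to the depot
at the end of a batch, whereas a robot drives there without the picker. -/
def target (sys : PickingSystem) (p : w.Pt) : I.Action → w.Pt
  | .pick x => I.loc x
  | .unload =>
    match sys with
    | .pcartN => w.depot
    | .pcart => w.depot
    | .robot => p

/-- The state after an action. -/
def perform (sys : PickingSystem) (s : I.State) : I.Action → I.State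
  | .pick x => ⟨I.loc x, insert x s.picked, insert x.1 s.cart⟩
  | .unload => ⟨target (I := I) sys s.pos .unload, s.picked, ∅⟩

/-- The time at which a sequence of actions, started in `p` at time `τ`, is completed, if every
item is picked as early as possible, but not before the arrival of its order. -/
def completion (sys : PickingSystem) : w.Pt → ℝ → List I.Action → ℝ
  | _, τ, [] => τ
  | p, τ, .pick x :: l =>
    completion sys (I.loc x) (max (τ + w.d p (I.loc x)) (I.arrival x.1)) l
  | p, τ, .unload :: l =>
    completion sys (target (I := I) sys p .unload)
      (τ + w.d p (target (I := I) sys p .unload)) l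

variable (I)

/-- The complete-information optimum: the least completion time of a plan for all orders that
starts at the depot at time `0`. -/
def CIOPT (sys : PickingSystem) : ℝ :=
  sInf {v | ∃ P : I.Plan, I.Feasible I.init Finset.univ P ∧
    v = completion sys w.depot 0 (I.actions P)}

/-! ### Reoptimization -/

/-- `P` is an optimal plan for what remains of the orders in `A`, from state `s` at time `τ`. -/
def OptimalPlan (sys : PickingSystem) (s : I.State) (τ : ℝ) (A : Finset (Fin I.n))
    (P : I.Plan) : Prop :=
  I.Feasible s A P ∧ ∀ Q : I.Plan, I.Feasible s A Q →
    completion sys s.pos τ (I.actions P) ≤ completion sys s.pos τ (I.actions Q)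

/-- `RunUntil sys T s τ l s'`: if the picker in state `s` at time `τ` carries out the actions `l`
(on orders which have already arrived), then `s'` is a possible state at time `T`. If she is on
her way at time `T`, then her position is a point at the right distance on a shortest path. -/
inductive RunUntil (sys : PickingSystem) (T : ℝ) :
    I.State → ℝ → List I.Action → I.State → Prop
  | idle (s : I.State) (τ : ℝ) : RunUntil sys T s τ [] s
  | act {s s' : I.State} {τ : ℝ} {α : I.Action} {l : List I.Action}
      (h : τ + w.d s.pos (target sys s.pos α) ≤ T)
      (hrun : RunUntil sys T (perform sys s α) (τ + w.d s.pos (target sys s.pos α)) l s') :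
      RunUntil sys T s τ (α :: l) s'
  | walking {s : I.State} {τ : ℝ} {α : I.Action} {l : List I.Action} (q : w.Pt)
      (h : T < τ + w.d s.pos (target sys s.pos α))
      (hq : w.d s.pos q = T - τ)
      (hq' : w.d q (target sys s.pos α) = w.d s.pos (target sys s.pos α) - (T - τ)) :
      RunUntil sys T s τ (α :: l) ⟨q, s.picked, s.cart⟩

/-- `V` is a possible result of interventionist reoptimization: the picker waits at the depot for
the first order; at the arrival of each order an optimal plan for the orders that have arrived is
chosen, and it is followed until the next arrival (after the last arrival, to its end). -/
def InterventionistResult (sys : PickingSystem) (V : ℝ) : Prop :=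
  (I.n = 0 → V = 0) ∧
  ∃ (s : Fin I.n → I.State) (P : Fin I.n → I.Plan),
    (∀ j : Fin I.n, (j : ℕ) = 0 → s j = I.init) ∧
    (∀ j, I.OptimalPlan sys (s j) (I.arrival j) (I.arrived (I.arrival j)) (P j)) ∧
    (∀ j k : Fin I.n, (k : ℕ) = j + 1 →
      I.RunUntil sys (I.arrival k) (s j) (I.arrival j) (I.actions (P j)) (s k)) ∧
    (∀ j : Fin I.n, (j : ℕ) + 1 = I.n →
      V = completion sys (s j).pos (I.arrival j) (I.actions (P j)))

/-- `NonInterventionistRun τ A D P V`: if at time `τ` the picker is at the depot with an empty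
pushcart, the items `D` have been picked, the last (re)optimization has taken into account the
orders `A`, and `P` is what remains of its plan, then `V` is a possible completion time of
non-interventionist reoptimization. -/
inductive NonInterventionistRun :
    ℝ → Finset (Fin I.n) → Finset I.Item → I.Plan → ℝ → Prop
  /-- new orders have arrived: reoptimize -/
  | replan {τ : ℝ} {A : Finset (Fin I.n)} {D : Finset I.Item} {P : I.Plan} {V : ℝ} (P' : I.Plan)
      (hnew : I.arrived τ ≠ A)
      (hopt : I.OptimalPlan .pcartN ⟨w.depot, D, ∅⟩ τ (I.arrived τ) P')
      (hrun : NonInterventionistRun τ (I.arrived τ) D P' V) :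
      NonInterventionistRun τ A D P V
  /-- no new orders: collect the next batch of the plan -/
  | batch {τ : ℝ} {A : Finset (Fin I.n)} {D : Finset I.Item} {B : List I.Item} {P : I.Plan} {V : ℝ}
      (hold : I.arrived τ = A)
      (hrun : NonInterventionistRun (completion .pcartN w.depot τ (I.batchActions B)) A
        (D ∪ B.toFinset) P V) :
      NonInterventionistRun τ A D (B :: P) V
  /-- all available orders are completed: wait for the next arrival -/
  | wait {τ : ℝ} {A : Finset (Fin I.n)} {D : Finset I.Item} {V : ℝ} (j : Fin I.n)
      (hold : I.arrived τ = A) (hj : j ∉ A) (hmin : ∀ k, k ∉ A → I.arrival j ≤ I.arrival k)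
      (hrun : NonInterventionistRun (I.arrival j) A D [] V) :
      NonInterventionistRun τ A D [] V
  /-- all orders are completed -/
  | finish {τ : ℝ} {D : Finset I.Item} (hall : I.arrived τ = Finset.univ) :
      NonInterventionistRun τ Finset.univ D [] τ

/-- `V` is a total completion time that Reopt can produce on `I` in the given picking system, for
some choice among optimal plans and among shortest paths. -/
def IsReoptResult (V : ℝ) : PickingSystem → Prop
  | .pcartN => I.NonInterventionistRun 0 ∅ ∅ [] V
  | .pcart => I.InterventionistResult .pcart V
  | .robot => I.InterventionistResult .robot V

/-- The optimality ratio of a result `V` on `I`, with value `1` on the instance without orders. -/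
def ratio (sys : PickingSystem) (V : ℝ) : ℝ := if I.n = 0 then 1 else V / I.CIOPT sys

end Instance

/-! ### Poisson arrivals -/

/-- The arrival time of the `j`-th order, for inter-arrival times `X`. -/
def arrivalTime (X : ℕ → ℝ) (j : ℕ) : ℝ := ∑ i ∈ Finset.range (j + 1), X i

/-- The number of arrivals in `[0, t]`. -/
def numArrivals (X : ℕ → ℝ) (t : ℝ) : ℕ := {j : ℕ | arrivalTime X j ≤ t}.ncard

/-- The instance that consists of the orders arriving in `[0, t]`. -/
def windowInstance (X : ℕ → ℝ) (O : ℕ → w.CustomerOrder) (t : ℝ) : Instance w where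
  n := numArrivals X t
  order j := O j
  arrival j := arrivalTime X j

/-- The random instance that consists of the orders arriving in `[0, t]`. -/
def randomInstance {Ω : Type*} (X : ℕ → Ω → ℝ) (O : ℕ → Ω → w.CustomerOrder) (t : ℝ) (ω : Ω) :
    Instance w :=
  windowInstance (fun j => X j ω) (fun j => O j ω) t

/-- The stochastic model: i.i.d. exponential inter-arrival times with rate `lam` (so that arrivals
form a homogeneous Poisson process) and, independently of them, i.i.d. orders with law `ν`. -/
structure PoissonModel {Ω : Type*} [MeasurableSpace Ω] (P : Measure Ω) (lam : ℝ)
    (ν : Measure w.CustomerOrder) (X : ℕ → Ω → ℝ) (O : ℕ → Ω → w.CustomerOrder) : Prop where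
  measurable_X : ∀ j, Measurable (X j)
  measurable_O : ∀ j, Measurable (O j)
  law_X : ∀ j, P.map (X j) = expMeasure lam
  law_O : ∀ j, P.map (O j) = ν
  indep_X : iIndepFun X P
  indep_O : iIndepFun O P
  indep : IndepFun (fun ω j => X j ω) (fun ω j => O j ω) P

end OOBSRP

end

/-!
Let `R ≤ t` be the last arrival time. The items picked up to time `R` can be put in front of any
plan for all orders, started at the depot, without violating feasibility, so Reopt is at least as
long as the optimum. Conversely, from time `R` on nothing is unknown: up to a constant `M` that
depends only on the warehouse, the remaining tour is at most as long as the tour of any plan for all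
orders. Hence `CIOPT ≤ Reopt ≤ t + M + CIOPT`, and Reopt is at most five times the optimum.

At most `c` orders share a batch, so every `c` orders with an item at distance at least `δ` from the
depot (for the robot: with two items at distance at least `δ` from each other) add `δ` to every
plan. For `δ` small such orders have positive probability, hence their number in `[0, t]`, and with
it `CIOPT`, tends to infinity in probability as the interarrival times tend to zero; if there is no
such `δ`, all items are at the depot, which is only possible with a pushcart and makes the ratio
equal to one. So the ratio tends to one in probability, and in mean because it is bounded.
-/

noncomputable section

namespace OOBSRP

variable {w : Warehouse}

/-! ### The walking distance -/

namespace Warehouse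

/-- The rectilinear distance in the plane, a lower bound for the walking distance. -/
def rectDist (p q : w.Pt) : ℝ := |p.1.1 - q.1.1| + |p.1.2 - q.1.2|

lemma rectDist_nonneg (p q : w.Pt) : 0 ≤ rectDist p q := by unfold rectDist; positivity

lemma rectDist_comm (p q : w.Pt) : rectDist p q = rectDist q p := by
  simp only [rectDist, abs_sub_comm]

lemma rectDist_triangle (p q r : w.Pt) : rectDist p r ≤ rectDist p q + rectDist q r := by
  have h₁ := abs_sub_le p.1.1 q.1.1 r.1.1
  have h₂ := abs_sub_le p.1.2 q.1.2 r.1.2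
  simp only [rectDist]
  linarith

lemma rectDist_pos {p q : w.Pt} (h : p ≠ q) : 0 < rectDist p q := by
  refine (rectDist_nonneg p q).lt_of_ne fun h₀ => h (Subtype.ext (Prod.ext ?_ ?_)) <;>
    refine sub_eq_zero.1 (abs_eq_zero.1 ?_) <;> unfold rectDist at h₀ <;>
    linarith [abs_nonneg (p.1.1 - q.1.1), abs_nonneg (p.1.2 - q.1.2)]

lemma GridPath.rectDist_le {p q : w.Pt} {l : ℝ} (h : w.GridPath p q l) : rectDist p q ≤ l := by
  induction h with
  | refl => simp [rectDist]
  | step r _ _ ih => exact (rectDist_triangle _ _ _).trans (add_le_add_left ih _)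

lemma GridPath.trans {p q r : w.Pt} {l l' : ℝ} (h : w.GridPath p q l) (h' : w.GridPath q r l') :
    w.GridPath p r (l + l') := by
  induction h' with
  | refl => simpa using h
  | step r _ hseg ih => rw [← add_assoc]; exact GridPath.step r ih hseg

lemma GridPath.of_segment_subset {p q : w.Pt} (hseg : segment ℝ p.1 q.1 ⊆ w.grid) :
    w.GridPath p q (rectDist p q) := by
  simpa [rectDist] using GridPath.step q (GridPath.refl p) hseg

lemma GridPath.symm {p q : w.Pt} {l : ℝ} (h : w.GridPath p q l) : w.GridPath q p l := by
  induction h with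
  | refl => exact GridPath.refl _
  | step r _ hseg ih =>
    rw [segment_symm] at hseg
    have h' := (GridPath.of_segment_subset hseg).trans ih
    rwa [rectDist_comm, add_comm] at h'

lemma GridPath.d_le {p q : w.Pt} {l : ℝ} (h : w.GridPath p q l) : w.d p q ≤ l :=
  csInf_le ⟨rectDist p q, fun _ h' => GridPath.rectDist_le h'⟩ h

lemma segment_subset_grid_of_onAisle {x y y' : ℝ} (h : w.OnAisle (x, y))
    (h' : w.OnAisle (x, y')) : segment ℝ (x, y) (x, y') ⊆ w.grid := by
  rw [← Prod.image_mk_segment_right]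
  rintro _ ⟨z, hz, rfl⟩
  exact Or.inl ⟨h.1, (convex_Icc (0 : ℝ) w.W).segment_subset h.2.1 h'.2.1 hz, h.2.2⟩

lemma segment_subset_grid_of_onCrossAisle {x x' y : ℝ} (h : w.OnCrossAisle (x, y))
    (h' : w.OnCrossAisle (x', y)) : segment ℝ (x, y) (x', y) ⊆ w.grid := by
  rw [← Prod.image_mk_segment_left]
  rintro _ ⟨z, hz, rfl⟩
  exact Or.inr ⟨(convex_Icc (0 : ℝ) w.L).segment_subset h.1 h'.1 hz, h.2.1, h.2.2⟩

lemma onAisle_zero_left {y : ℝ} (hy : y ∈ Set.Icc 0 w.W) : w.OnAisle (0, y) :=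
  ⟨⟨le_rfl, w.L_pos.le⟩, hy, 0, w.one_le_a, by simp⟩

lemma onCrossAisle_zero_right {x : ℝ} (hx : x ∈ Set.Icc 0 w.L) : w.OnCrossAisle (x, 0) :=
  ⟨hx, ⟨le_rfl, w.W_pos.le⟩, 0, zero_lt_two.trans_le w.two_le_b, by simp⟩

/-- The corner `(0, 0)` of the grid, through which any two points can be connected. -/
def corner (w : Warehouse) : w.Pt :=
  ⟨(0, 0), Or.inl (onAisle_zero_left ⟨le_rfl, w.W_pos.le⟩)⟩

lemma rectDist_corner_le (p : w.Pt) : rectDist p w.corner ≤ w.L + w.W := by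
  have h : p.1.1 ∈ Set.Icc 0 w.L ∧ p.1.2 ∈ Set.Icc 0 w.W := by
    obtain h | h := p.2 <;> exact ⟨h.1, h.2.1⟩
  simp only [rectDist, corner, sub_zero, abs_of_nonneg h.1.1, abs_of_nonneg h.2.1]
  exact add_le_add h.1.2 h.2.2

lemma gridPath_corner (p : w.Pt) : w.GridPath p w.corner (rectDist p w.corner) := by
  obtain ⟨⟨x, y⟩, h | h⟩ := p
  · have h₀ : w.OnAisle (x, 0) := ⟨h.1, ⟨le_rfl, w.W_pos.le⟩, h.2.2⟩
    have down : w.GridPath ⟨(x, y), Or.inl h⟩ ⟨(x, 0), Or.inl h₀⟩ _ :=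
      .of_segment_subset (segment_subset_grid_of_onAisle h h₀)
    have left : w.GridPath ⟨(x, 0), Or.inl h₀⟩ w.corner _ :=
      .of_segment_subset (segment_subset_grid_of_onCrossAisle (onCrossAisle_zero_right h.1)
        (onCrossAisle_zero_right ⟨le_rfl, w.L_pos.le⟩))
    convert down.trans left using 1
    simp [rectDist, corner, add_comm]
  · have h₀ : w.OnCrossAisle (0, y) := ⟨⟨le_rfl, w.L_pos.le⟩, h.2.1, h.2.2⟩
    have left : w.GridPath ⟨(x, y), Or.inr h⟩ ⟨(0, y), Or.inr h₀⟩ _ :=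
      .of_segment_subset (segment_subset_grid_of_onCrossAisle h h₀)
    have down : w.GridPath ⟨(0, y), Or.inr h₀⟩ w.corner _ :=
      .of_segment_subset (segment_subset_grid_of_onAisle (onAisle_zero_left h.2.1)
        (onAisle_zero_left ⟨le_rfl, w.W_pos.le⟩))
    convert left.trans down using 1
    simp [rectDist, corner]

lemma nonempty_gridPath (p q : w.Pt) : {l | w.GridPath p q l}.Nonempty :=
  ⟨_, (gridPath_corner p).trans (gridPath_corner q).symm⟩

/-- An upper bound for the walking distances, attained by a detour through the corner. -/
def diamBound (w : Warehouse) : ℝ := 2 * (w.L + w.W)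

lemma diamBound_nonneg : 0 ≤ w.diamBound := by
  have := w.L_pos
  have := w.W_pos
  unfold diamBound
  positivity

lemma d_le_diamBound (p q : w.Pt) : w.d p q ≤ w.diamBound := by
  refine ((gridPath_corner p).trans (gridPath_corner q).symm).d_le.trans ?_
  unfold diamBound
  linarith [rectDist_corner_le p, rectDist_corner_le q]

lemma rectDist_le_d (p q : w.Pt) : rectDist p q ≤ w.d p q :=
  le_csInf (nonempty_gridPath p q) fun _ h => GridPath.rectDist_le h

lemma d_nonneg (p q : w.Pt) : 0 ≤ w.d p q := (rectDist_nonneg p q).trans (rectDist_le_d p q)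

@[simp] lemma d_self (p : w.Pt) : w.d p p = 0 :=
  le_antisymm (GridPath.refl p).d_le (d_nonneg p p)

lemma d_comm (p q : w.Pt) : w.d p q = w.d q p :=
  congrArg sInf (Set.ext fun _ => ⟨GridPath.symm, GridPath.symm⟩)

lemma d_triangle (p q r : w.Pt) : w.d p r ≤ w.d p q + w.d q r := by
  rw [← sub_le_iff_le_add]
  refine le_csInf (nonempty_gridPath p q) fun l hl => ?_
  rw [sub_le_iff_le_add', ← sub_le_iff_le_add]
  refine le_csInf (nonempty_gridPath q r) fun l' hl' => ?_
  rw [sub_le_iff_le_add']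
  exact (hl.trans hl').d_le

lemma d_le_of_same_aisle {p q : w.Pt} (hp : w.OnAisle p.1) (hq : w.OnAisle q.1)
    (h : p.1.1 = q.1.1) : w.d p q ≤ |p.1.2 - q.1.2| := by
  obtain ⟨⟨x, y⟩, hp'⟩ := p
  obtain ⟨⟨x', y'⟩, hq'⟩ := q
  obtain rfl : x = x' := h
  simpa [rectDist] using (GridPath.of_segment_subset (p := ⟨(x, y), hp'⟩) (q := ⟨(x, y'), hq'⟩)
    (segment_subset_grid_of_onAisle hp hq)).d_le

/-! ### Walks -/

/-- The length of a walk that starts in a point and visits the points of a list in order. -/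
def walk : w.Pt → List w.Pt → ℝ
  | _, [] => 0
  | p, q :: l => w.d p q + walk q l

@[simp] lemma walk_nil (p : w.Pt) : walk p [] = 0 := rfl

@[simp] lemma walk_cons (p q : w.Pt) (l : List w.Pt) : walk p (q :: l) = w.d p q + walk q l := rfl

lemma walk_nonneg (p : w.Pt) (l : List w.Pt) : 0 ≤ walk p l := by
  induction l generalizing p with
  | nil => exact le_rfl
  | cons q l ih => exact add_nonneg (d_nonneg _ _) (ih q)

lemma walk_le_d_add_walk (p q : w.Pt) (l : List w.Pt) : walk p l ≤ w.d p q + walk q l := by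
  cases l with
  | nil => simpa using d_nonneg p q
  | cons r l => simp only [walk_cons]; linarith [d_triangle p q r]

lemma walk_append (p : w.Pt) (l l' : List w.Pt) :
    walk p (l ++ l') = walk p l + walk (l.getLastD p) l' := by
  induction l generalizing p with
  | nil => simp
  | cons q l ih =>
    simp only [List.cons_append, walk_cons, ih, List.getLastD_cons]
    ring

lemma d_getLastD_le_walk (p : w.Pt) (l : List w.Pt) : w.d p (l.getLastD p) ≤ walk p l := by
  induction l generalizing p with
  | nil => simp
  | cons q l ih =>
    simp only [walk_cons, List.getLastD_cons]
    linarith [d_triangle p q (l.getLastD q), ih q]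

lemma walk_le_of_sublist {l l' : List w.Pt} (h : l.Sublist l') (p : w.Pt) :
    walk p l ≤ walk p l' := by
  induction h generalizing p with
  | slnil => exact le_rfl
  | cons q _ ih => exact (walk_le_d_add_walk p q _).trans (add_le_add_right (ih q) _)
  | cons_cons q _ ih => exact add_le_add_right (ih q) _

lemma walk_eq_zero {p : w.Pt} {l : List w.Pt} (h : ∀ q ∈ l, q = p) : walk p l = 0 := by
  induction l with
  | nil => rfl
  | cons q l ih =>
    obtain rfl := h q (by simp)
    rw [walk_cons, d_self, zero_add, ih fun r hr => h r (List.mem_cons_of_mem _ hr)]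

lemma walk_cons_le_of_sorted_aisle {p : w.Pt} {l : List w.Pt}
    (hl : ∀ q ∈ p :: l, w.OnAisle q.1 ∧ q.1.1 = p.1.1)
    (hs : (p :: l).Pairwise fun q r => q.1.2 ≤ r.1.2) : walk p l ≤ w.W - p.1.2 := by
  induction l generalizing p with
  | nil => simpa using (hl p (by simp)).1.2.1.2
  | cons q l ih =>
    obtain ⟨hp, hs⟩ := List.pairwise_cons.1 hs
    have hpq := hp q (by simp)
    obtain ⟨hq, hx⟩ := hl q (by simp)
    have hd : w.d p q ≤ q.1.2 - p.1.2 := by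
      simpa [abs_sub_comm, abs_of_nonneg, hpq] using
        d_le_of_same_aisle (hl p (by simp)).1 hq hx.symm
    have hrest := ih (fun r hr => ⟨(hl r (.tail _ hr)).1, (hl r (.tail _ hr)).2.trans hx.symm⟩) hs
    rw [walk_cons]
    linarith

lemma walk_le_of_sorted_aisle (p : w.Pt) {l : List w.Pt} {x : ℝ}
    (hl : ∀ q ∈ l, w.OnAisle q.1 ∧ q.1.1 = x) (hs : l.Pairwise fun q r => q.1.2 ≤ r.1.2) :
    walk p l ≤ w.diamBound + w.W := by
  cases l with
  | nil => exact add_nonneg diamBound_nonneg w.W_pos.le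
  | cons q l =>
    have hq := hl q (by simp)
    have := walk_cons_le_of_sorted_aisle (fun r hr => ⟨(hl r hr).1, (hl r hr).2.trans hq.2.symm⟩) hs
    rw [walk_cons]
    linarith [d_le_diamBound p q, hq.1.2.1.1]

lemma exists_perm_walk_map_le {α : Type*} (f : α → w.Pt) (S : Finset ℝ) (l : List α)
    (hl : ∀ z ∈ l, w.OnAisle (f z).1 ∧ (f z).1.1 ∈ S) :
    ∃ l' : List α, l'.Perm l ∧ ∀ p, walk p (l'.map f) ≤ S.card * (w.diamBound + w.W) := by
  induction S using Finset.induction_on generalizing l with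
  | empty =>
    obtain rfl : l = [] := List.eq_nil_iff_forall_not_mem.2 fun z hz => by simpa using (hl z hz).2
    exact ⟨[], .refl _, by simp⟩
  | insert x S hx ih =>
    let onX : α → Bool := fun z => (f z).1.1 = x
    let below : α → α → Prop := fun y z => (f y).1.2 ≤ (f z).1.2
    have : Std.Total below := ⟨fun y z => le_total _ _⟩
    have : IsTrans α below := ⟨fun _ _ _ => le_trans (α := ℝ)⟩
    obtain ⟨rest, hrest, hrest_le⟩ := ih (l.filter fun z => !onX z) fun z hz => by
      obtain ⟨hz, hzx⟩ := List.mem_filter.1 hz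
      exact ⟨(hl z hz).1, (Finset.mem_insert.1 (hl z hz).2).resolve_left (by simpa [onX] using hzx)⟩
    let first := (l.filter onX).insertionSort below
    have hfirst : first.Perm (l.filter onX) := List.perm_insertionSort _ _
    have hfirst_le (p : w.Pt) : walk p (first.map f) ≤ w.diamBound + w.W := by
      refine walk_le_of_sorted_aisle (x := x) p (List.forall_mem_map.2 fun z hz => ?_)
        (List.pairwise_map.2 (List.pairwise_insertionSort below _))
      obtain ⟨hz, hzx⟩ := List.mem_filter.1 (hfirst.mem_iff.1 hz)
      exact ⟨(hl z hz).1, by simpa [onX] using hzx⟩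
    refine ⟨first ++ rest, (hfirst.append hrest).trans (List.filter_append_perm _ l), fun p => ?_⟩
    rw [List.map_append, walk_append, Finset.card_insert_of_notMem hx]
    push_cast
    linarith [hrest_le ((first.map f).getLastD p), hfirst_le p]

/-- An upper bound for the length of a shortest tour, ending at the depot, through any finite set
of picking locations: sweep the aisles one after the other and return. -/
def batchBound (w : Warehouse) : ℝ := w.a * (w.diamBound + w.W) + w.diamBound

lemma batchBound_nonneg : 0 ≤ w.batchBound := by
  have := w.W_pos
  have := w.diamBound_nonneg
  unfold batchBound
  positivity

lemma exists_perm_walk_depot_le {α : Type*} (f : α → w.Pt) (l : List α)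
    (hl : ∀ z ∈ l, w.OnAisle (f z).1) :
    ∃ l' : List α, l'.Perm l ∧ ∀ p, walk p (l'.map f ++ [w.depot]) ≤ w.batchBound := by
  have hW := w.W_pos
  have hD := w.diamBound_nonneg
  let S : Finset ℝ := (Finset.range w.a).image fun i : ℕ => i * (w.L / ((w.a : ℝ) - 1))
  have hS : S.card ≤ w.a := Finset.card_image_le.trans_eq (Finset.card_range _)
  obtain ⟨l', hl', hle⟩ := exists_perm_walk_map_le f S l fun z hz => by
    obtain ⟨i, hi, hx⟩ := (hl z hz).2.2
    exact ⟨hl z hz, Finset.mem_image.2 ⟨i, Finset.mem_range.2 hi, hx.symm⟩⟩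
  refine ⟨l', hl', fun p => ?_⟩
  calc walk p (l'.map f ++ [w.depot])
      = walk p (l'.map f) + w.d ((l'.map f).getLastD p) w.depot := by simp [walk_append]
    _ ≤ S.card * (w.diamBound + w.W) + w.diamBound := add_le_add (hle p) (d_le_diamBound _ _)
    _ ≤ w.batchBound := by unfold batchBound; gcongr

end Warehouse

namespace Instance

open Warehouse

variable {I : Instance w}

/-! ### Completion times -/

@[simp] lemma actions_nil : I.actions [] = [] := rfl

@[simp] lemma actions_nil_cons (P : I.Plan) : I.actions ([] :: P) = .unload :: I.actions P := rfl

@[simp] lemma actions_cons_cons (x : I.Item) (B : List I.Item) (P : I.Plan) :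
    I.actions ((x :: B) :: P) = .pick x :: I.actions (B :: P) := rfl

lemma actions_cons (B : List I.Item) (P : I.Plan) :
    I.actions (B :: P) = I.batchActions B ++ I.actions P := rfl

lemma pick_mem_actions {P : I.Plan} {x : I.Item} :
    Action.pick x ∈ I.actions P ↔ x ∈ P.flatten := by
  simp [actions, batchActions]

/-- The points that the picker visits in order to conclude a batch. -/
def unloadStops (w : Warehouse) : PickingSystem → List w.Pt
  | .pcartN => [w.depot]
  | .pcart => [w.depot]
  | .robot => []

/-- The points that the picker visits in order to carry out an action. -/
def stops (sys : PickingSystem) : I.Action → List w.Pt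
  | .pick x => [I.loc x]
  | .unload => unloadStops w sys

/-- The points that the picker visits in order to carry out a sequence of actions. -/
def route (sys : PickingSystem) (l : List I.Action) : List w.Pt := l.flatMap (stops sys)

@[simp] lemma route_nil (sys : PickingSystem) : route sys ([] : List I.Action) = [] := rfl

@[simp] lemma route_pick_cons (sys : PickingSystem) (x : I.Item) (l : List I.Action) :
    route sys (.pick x :: l) = I.loc x :: route sys l := rfl

@[simp] lemma route_unload_cons (sys : PickingSystem) (l : List I.Action) :
    route sys (.unload :: l) = unloadStops w sys ++ route sys l := rfl

lemma route_append (sys : PickingSystem) (l l' : List I.Action) :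
    route sys (l ++ l') = route sys l ++ route sys l' := List.flatMap_append

lemma route_batchActions (sys : PickingSystem) (B : List I.Item) :
    route sys (I.batchActions B) = B.map I.loc ++ unloadStops w sys := by
  induction B with
  | nil => exact List.append_nil _
  | cons x B ih => exact congrArg (I.loc x :: ·) ih

lemma route_actions_cons (sys : PickingSystem) (B : List I.Item) (P : I.Plan) :
    route sys (I.actions (B :: P)) =
      B.map I.loc ++ unloadStops w sys ++ route sys (I.actions P) := by
  rw [actions_cons, route_append, route_batchActions]

lemma map_loc_flatten_sublist_route (sys : PickingSystem) (P : I.Plan) :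
    (P.flatten.map I.loc).Sublist (route sys (I.actions P)) := by
  induction P with
  | nil => exact List.Sublist.refl _
  | cons B P ih =>
    rw [List.flatten_cons, List.map_append, route_actions_cons]
    exact (List.sublist_append_left _ _).append ih

lemma target_unload (sys : PickingSystem) (p : w.Pt) :
    target (I := I) sys p .unload = (unloadStops w sys).getLastD p := by
  cases sys <;> rfl

lemma d_target_unload (sys : PickingSystem) (p : w.Pt) :
    w.d p (target (I := I) sys p .unload) = walk p (unloadStops w sys) := by
  cases sys <;> simp [target, unloadStops]

lemma perform_pos (sys : PickingSystem) (s : I.State) (α : I.Action) :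
    (perform sys s α).pos = target sys s.pos α := by
  cases α <;> rfl

lemma add_walk_le_completion (sys : PickingSystem) (p : w.Pt) (τ : ℝ) (l : List I.Action) :
    τ + walk p (route sys l) ≤ completion sys p τ l := by
  induction l generalizing p τ with
  | nil => simp [completion]
  | cons α l ih =>
    cases α with
    | pick x =>
      rw [route_pick_cons, walk_cons, completion]
      refine le_trans ?_ (ih _ _)
      linarith [le_max_left (τ + w.d p (I.loc x)) (I.arrival x.1)]
    | unload =>
      rw [route_unload_cons, walk_append, completion]
      refine le_trans ?_ (ih _ _)
      rw [d_target_unload, target_unload, add_assoc]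

lemma completion_eq_add_walk (sys : PickingSystem) (p : w.Pt) {τ : ℝ} {l : List I.Action}
    (h : ∀ x, Action.pick x ∈ l → I.arrival x.1 ≤ τ) :
    completion sys p τ l = τ + walk p (route sys l) := by
  induction l generalizing p τ with
  | nil => simp [completion]
  | cons α l ih =>
    have hl x (hx : Action.pick x ∈ l) : I.arrival x.1 ≤ τ := h x (List.mem_cons_of_mem _ hx)
    cases α with
    | pick x =>
      have hx : I.arrival x.1 ≤ τ + w.d p (I.loc x) :=
        (h x (by simp)).trans (le_add_of_nonneg_right (d_nonneg _ _))
      rw [route_pick_cons, walk_cons, completion, max_eq_left hx,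
        ih _ fun y hy => (hl y hy).trans (le_add_of_nonneg_right (d_nonneg _ _)), add_assoc]
    | unload =>
      rw [route_unload_cons, walk_append, completion, d_target_unload, target_unload,
        ih _ fun y hy => (hl y hy).trans (le_add_of_nonneg_right (walk_nonneg _ _)), add_assoc]

lemma le_completion (sys : PickingSystem) (p : w.Pt) (τ : ℝ) (l : List I.Action) :
    τ ≤ completion sys p τ l :=
  (le_add_of_nonneg_right (walk_nonneg _ _)).trans (add_walk_le_completion sys p τ l)

lemma arrival_le_completion (sys : PickingSystem) (p : w.Pt) (τ : ℝ) {l : List I.Action}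
    {x : I.Item} (hx : Action.pick x ∈ l) : I.arrival x.1 ≤ completion sys p τ l := by
  induction l generalizing p τ with
  | nil => cases hx
  | cons α l ih =>
    rcases List.mem_cons.1 hx with rfl | hx'
    · exact (le_max_right _ _).trans (le_completion _ _ _ _)
    · cases α <;> exact ih _ _ hx'

lemma completion_mono (sys : PickingSystem) {p p' : w.Pt} {τ τ' : ℝ} (h : τ + w.d p p' ≤ τ')
    (l : List I.Action) : completion sys p τ l ≤ completion sys p' τ' l := by
  induction l generalizing p p' τ τ' with
  | nil => exact (le_add_of_nonneg_right (d_nonneg p p')).trans h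
  | cons α l ih =>
    have hq (q : w.Pt) : τ + w.d p q ≤ τ' + w.d p' q := by linarith [d_triangle p p' q]
    cases α with
    | pick x => exact ih (by rw [d_self, add_zero]; exact max_le_max (hq _) le_rfl)
    | unload =>
      refine ih ?_
      cases sys <;> simp only [target, d_self, add_zero] <;> first | exact hq _ | exact h

lemma completion_append (sys : PickingSystem) (p : w.Pt) (τ : ℝ) (l l' : List I.Action) :
    completion sys p τ (l ++ l') =
      completion sys ((route sys l).getLastD p) (completion sys p τ l) l' := by
  induction l generalizing p τ with
  | nil => rfl
  | cons α l ih =>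
    cases α with
    | pick x => simp only [List.cons_append, completion, route_pick_cons, List.getLastD_cons, ih]
    | unload =>
      rw [List.cons_append, completion, completion, ih, route_unload_cons]
      cases sys <;> simp only [target, unloadStops, List.cons_append, List.nil_append,
        List.getLastD_cons]

/-! ### Feasible plans -/

lemma mem_ordersOf {B : List I.Item} {j : Fin I.n} :
    j ∈ I.ordersOf B ↔ ∃ x ∈ B, x.1 = j := by
  simp [ordersOf]

lemma ordersOf_mono {B B' : List I.Item} (h : B ⊆ B') : I.ordersOf B ⊆ I.ordersOf B' := by
  intro j hj
  obtain ⟨x, hx, rfl⟩ := mem_ordersOf.1 hj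
  exact mem_ordersOf.2 ⟨x, h hx, rfl⟩

lemma ordersOf_congr {B B' : List I.Item} (h : ∀ x, x ∈ B ↔ x ∈ B') :
    I.ordersOf B = I.ordersOf B' :=
  (ordersOf_mono fun x => (h x).1).antisymm (ordersOf_mono fun x => (h x).2)

lemma ordersOf_cons (x : I.Item) (B : List I.Item) :
    I.ordersOf (x :: B) = insert x.1 (I.ordersOf B) := by
  simp [ordersOf]

/-- `B` can be the first batch of a feasible plan for what remains of the orders in `A` from
state `s`. -/
structure FeasibleBatch (s : I.State) (A : Finset (Fin I.n)) (B : List I.Item) : Prop where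
  nodup : B.Nodup
  remaining : ∀ x ∈ B, x.1 ∈ A ∧ x ∉ s.picked
  unsplit : ∀ x : I.Item, x.1 ∈ A → x.1 ∈ s.cart ∪ I.ordersOf B → x ∈ s.picked ∨ x ∈ B
  capacity : (s.cart ∪ I.ordersOf B).card ≤ w.c
  ne_nil : s.cart = ∅ → B ≠ []

lemma Feasible.head {s : I.State} {A : Finset (Fin I.n)} {B : List I.Item} {P : I.Plan}
    (h : I.Feasible s A (B :: P)) : FeasibleBatch s A B where
  nodup := (List.nodup_append.1 h.nodup).1
  remaining x hx := (h.complete x).1 (List.mem_append_left _ hx)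
  unsplit x hxA hx := by
    refine or_iff_not_imp_left.2 fun hxs => ?_
    have hxP := (h.complete x).2 ⟨hxA, hxs⟩
    rcases Finset.mem_union.1 hx with hx | hx
    · exact h.commenced x hxP hx
    · obtain ⟨y, hy, hyx⟩ := mem_ordersOf.1 hx
      exact h.unsplit B (by simp) y hy x hxP hyx.symm
  capacity := h.capacity_head
  ne_nil hs := h.nonempty_head hs B (by simp)

lemma Feasible.tail {s : I.State} {A : Finset (Fin I.n)} {B : List I.Item} {P : I.Plan}
    (h : I.Feasible s A (B :: P)) (q : w.Pt) :
    I.Feasible ⟨q, s.picked ∪ B.toFinset, ∅⟩ A P where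
  nodup := (List.nodup_append.1 h.nodup).2.1
  complete x := by
    have hdisj := (List.nodup_append.1 h.nodup).2.2
    have hx := h.complete x
    simp only [List.flatten_cons, List.mem_append] at hx
    simp only [Finset.mem_union, List.mem_toFinset, not_or]
    exact ⟨fun hP => ⟨(hx.1 (.inr hP)).1, (hx.1 (.inr hP)).2, fun hB => hdisj x hB x hP rfl⟩,
      fun ⟨hA, hs, hB⟩ => (hx.2 ⟨hA, hs⟩).resolve_left hB⟩
  unsplit B' hB' x hx y hy :=
    h.unsplit B' (List.mem_cons_of_mem _ hB') x hx y (List.mem_append_right _ hy)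
  commenced x _ hx := absurd hx (Finset.notMem_empty _)
  continues h := absurd h Finset.not_nonempty_empty
  capacity_head := by
    cases P with
    | nil => simp [ordersOf]
    | cons B' P => simpa using h.capacity_tail B' (by simp)
  capacity_tail B' hB' := h.capacity_tail B' (List.mem_of_mem_tail hB')
  nonempty_head _ := h.nonempty_tail
  nonempty_tail B' hB' := h.nonempty_tail B' (List.mem_of_mem_tail hB')

lemma Feasible.card_ordersOf_le {s : I.State} {A : Finset (Fin I.n)} {P : I.Plan}
    (h : I.Feasible s A P) {B : List I.Item} (hB : B ∈ P) : (I.ordersOf B).card ≤ w.c := by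
  obtain ⟨B', P, rfl⟩ := List.exists_cons_of_ne_nil (List.ne_nil_of_mem hB)
  rcases List.mem_cons.1 hB with rfl | hB
  · exact (Finset.card_le_card Finset.subset_union_right).trans h.capacity_head
  · exact h.capacity_tail B hB

lemma FeasibleBatch.feasible_cons {s : I.State} {A : Finset (Fin I.n)} {B : List I.Item}
    {P : I.Plan} {q : w.Pt} (hB : FeasibleBatch s A B)
    (hP : I.Feasible ⟨q, s.picked ∪ B.toFinset, ∅⟩ A P) : I.Feasible s A (B :: P) := by
  have mem_P (x : I.Item) : x ∈ P.flatten ↔ x.1 ∈ A ∧ x ∉ s.picked ∧ x ∉ B := by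
    simpa using hP.complete x
  have mem_B {x : I.Item} (hx : x ∈ (B :: P).flatten) (hxB : x.1 ∈ s.cart ∪ I.ordersOf B) :
      x ∈ B := by
    rcases List.mem_append.1 hx with hx | hx
    · exact hx
    · obtain ⟨hxA, hxs, -⟩ := (mem_P x).1 hx
      exact (hB.unsplit x hxA hxB).resolve_left hxs
  have mem_ordersOf_B {x : I.Item} (hx : x ∈ B) : x.1 ∈ s.cart ∪ I.ordersOf B :=
    Finset.mem_union_right _ (mem_ordersOf.2 ⟨x, hx, rfl⟩)
  refine ⟨List.nodup_append.2 ⟨hB.nodup, hP.nodup, ?_⟩, fun x => ?_, ?_,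
    fun x hx hxs => mem_B hx (Finset.mem_union_left _ hxs), fun _ => List.cons_ne_nil _ _,
    hB.capacity, fun _ => hP.card_ordersOf_le,
    fun hs => List.forall_mem_cons.2 ⟨hB.ne_nil hs, hP.nonempty_head rfl⟩, hP.nonempty_head rfl⟩
  · rintro x hx _ hxP rfl
    exact ((mem_P x).1 hxP).2.2 hx
  · rw [List.flatten_cons, List.mem_append, mem_P]
    have := hB.remaining x
    tauto
  · intro B' hB' x hx y hy hyx
    rcases List.mem_cons.1 hB' with rfl | hB'
    · exact mem_B hy (hyx ▸ mem_ordersOf_B hx)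
    · have hxP := List.mem_flatten.2 ⟨B', hB', hx⟩
      rcases List.mem_append.1 hy with hy | hy
      · exact absurd (mem_B (List.mem_append_right _ hxP) (hyx ▸ mem_ordersOf_B hy))
          ((mem_P x).1 hxP).2.2
      · exact hP.unsplit B' hB' x hx y hy hyx

lemma feasible_cons_iff {s : I.State} {A : Finset (Fin I.n)} {B : List I.Item} {P : I.Plan}
    (q : w.Pt) : I.Feasible s A (B :: P) ↔
      FeasibleBatch s A B ∧ I.Feasible ⟨q, s.picked ∪ B.toFinset, ∅⟩ A P :=
  ⟨fun h => ⟨h.head, h.tail q⟩, fun h => h.1.feasible_cons h.2⟩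

lemma FeasibleBatch.mono {s : I.State} {A A' : Finset (Fin I.n)} {B : List I.Item}
    (h : FeasibleBatch s A B) (hs : s.cart ⊆ A) (hA : A ⊆ A') : FeasibleBatch s A' B where
  nodup := h.nodup
  remaining x hx := ⟨hA (h.remaining x hx).1, (h.remaining x hx).2⟩
  unsplit x _ hx := by
    refine h.unsplit x ?_ hx
    rcases Finset.mem_union.1 hx with hx | hx
    · exact hs hx
    · obtain ⟨y, hy, hyx⟩ := mem_ordersOf.1 hx
      exact hyx ▸ (h.remaining y hy).1
  capacity := h.capacity
  ne_nil := h.ne_nil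

lemma FeasibleBatch.perm {s : I.State} {A : Finset (Fin I.n)} {B B' : List I.Item}
    (h : FeasibleBatch s A B) (hB : B'.Perm B) : FeasibleBatch s A B' where
  nodup := hB.nodup_iff.2 h.nodup
  remaining x hx := h.remaining x (hB.mem_iff.1 hx)
  unsplit x hxA hx := by
    rw [ordersOf_congr fun _ => hB.mem_iff] at hx
    rw [hB.mem_iff]
    exact h.unsplit x hxA hx
  capacity := by
    rw [ordersOf_congr fun _ => hB.mem_iff]
    exact h.capacity
  ne_nil hs := by
    rintro rfl
    exact h.ne_nil hs hB.symm.eq_nil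

lemma feasibleBatch_cons_iff (sys : PickingSystem) {s : I.State} {A : Finset (Fin I.n)}
    {x : I.Item} {B : List I.Item} :
    FeasibleBatch s A (x :: B) ↔
      (x.1 ∈ A ∧ x ∉ s.picked) ∧ FeasibleBatch (perform sys s (.pick x)) A B := by
  have hcart : s.cart ∪ I.ordersOf (x :: B) =
      (perform sys s (.pick x)).cart ∪ I.ordersOf B := by
    rw [ordersOf_cons, Finset.union_insert, ← Finset.insert_union]
    rfl
  constructor
  · refine fun h => ⟨h.remaining x (by simp), (List.nodup_cons.1 h.nodup).2, fun y hy => ?_,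
      fun y hyA hy => ?_, hcart ▸ h.capacity, fun h => absurd h (Finset.insert_ne_empty _ _)⟩
    · have hyx : y ≠ x := fun e => (List.nodup_cons.1 h.nodup).1 (e ▸ hy)
      simpa [perform, hyx] using h.remaining y (List.mem_cons_of_mem _ hy)
    · have := h.unsplit y hyA (hcart ▸ hy)
      simp only [List.mem_cons, perform, Finset.mem_insert] at this ⊢
      tauto
  · rintro ⟨hx, h⟩
    refine ⟨List.nodup_cons.2 ⟨fun hxB => ?_, h.nodup⟩, fun y hy => ?_, fun y hyA hy => ?_,
      hcart ▸ h.capacity, fun _ => List.cons_ne_nil _ _⟩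
    · simpa [perform] using (h.remaining x hxB).2
    · rcases List.mem_cons.1 hy with rfl | hy
      · exact hx
      · exact (h.remaining y hy).imp_right fun h => fun hys => h (Finset.mem_insert_of_mem hys)
    · have := h.unsplit y hyA (hcart ▸ hy)
      simp only [List.mem_cons, perform, Finset.mem_insert] at this ⊢
      tauto

lemma feasible_pick_iff (sys : PickingSystem) {s : I.State} {A : Finset (Fin I.n)} {x : I.Item}
    {B : List I.Item} {P : I.Plan} :
    I.Feasible s A ((x :: B) :: P) ↔
      (x.1 ∈ A ∧ x ∉ s.picked) ∧ I.Feasible (perform sys s (.pick x)) A (B :: P) := by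
  have hpicked : s.picked ∪ (x :: B).toFinset = (perform sys s (.pick x)).picked ∪ B.toFinset := by
    rw [List.toFinset_cons, Finset.union_insert, ← Finset.insert_union]
    rfl
  rw [feasible_cons_iff w.depot, feasible_cons_iff w.depot, feasibleBatch_cons_iff sys, hpicked,
    and_assoc]

lemma feasible_unload_iff (sys : PickingSystem) {s : I.State} {A : Finset (Fin I.n)}
    {P : I.Plan} :
    I.Feasible s A ([] :: P) ↔ FeasibleBatch s A [] ∧ I.Feasible (perform sys s .unload) A P := by
  rw [feasible_cons_iff (target (I := I) sys s.pos .unload), List.toFinset_nil, Finset.union_empty]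
  rfl

lemma Feasible.congr_pos {s : I.State} {A : Finset (Fin I.n)} {P : I.Plan}
    (h : I.Feasible s A P) (q : w.Pt) : I.Feasible ⟨q, s.picked, s.cart⟩ A P :=
  ⟨h.1, h.2, h.3, h.4, h.5, h.6, h.7, h.8, h.9⟩

/-- `P` is a feasible plan for the whole instance. -/
abbrev IsFullPlan (P : I.Plan) : Prop := I.Feasible I.init Finset.univ P

lemma IsFullPlan.mem_flatten {P : I.Plan} (h : IsFullPlan P) (x : I.Item) : x ∈ P.flatten :=
  (h.complete x).2 ⟨Finset.mem_univ _, Finset.notMem_empty _⟩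

/-- The completion time of a plan that is started at the depot at time `0`. -/
abbrev makespan (sys : PickingSystem) (P : I.Plan) : ℝ := completion sys w.depot 0 (I.actions P)

/-- The distance walked if a plan is carried out from the depot. -/
abbrev planLength (sys : PickingSystem) (P : I.Plan) : ℝ :=
  walk w.depot (route sys (I.actions P))

lemma planLength_le_makespan (sys : PickingSystem) (P : I.Plan) :
    planLength sys P ≤ makespan sys P :=
  (zero_add _).symm.trans_le (add_walk_le_completion sys w.depot 0 _)

lemma IsFullPlan.arrival_le_makespan {P : I.Plan} (h : IsFullPlan P) (sys : PickingSystem)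
    (j : Fin I.n) : I.arrival j ≤ makespan sys P :=
  arrival_le_completion sys w.depot 0
    (pick_mem_actions.2 (h.mem_flatten ⟨j, ⟨0, (I.order j).2.1⟩⟩))

/-- The part of a plan that concerns the items with the property `p`, without void batches. -/
def restrict (P : I.Plan) (p : I.Item → Bool) : I.Plan :=
  (P.map (List.filter p)).filter fun B => !B.isEmpty

lemma mem_restrict {P : I.Plan} {p : I.Item → Bool} {B : List I.Item} :
    B ∈ restrict P p ↔ B ≠ [] ∧ ∃ B' ∈ P, B'.filter p = B := by
  simp [restrict, and_comm]

lemma flatten_restrict (P : I.Plan) (p : I.Item → Bool) :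
    (restrict P p).flatten = P.flatten.filter p := by
  rw [restrict, List.flatten_filter_not_isEmpty, List.filter_flatten]

lemma route_restrict_sublist (sys : PickingSystem) (P : I.Plan) (p : I.Item → Bool) :
    (route sys (I.actions (restrict P p))).Sublist (route sys (I.actions P)) := by
  induction P with
  | nil => exact List.Sublist.refl _
  | cons B P ih =>
    unfold restrict at ih ⊢
    rw [route_actions_cons, List.map_cons, List.filter_cons]
    split_ifs
    · rw [route_actions_cons]
      exact ((List.filter_sublist.map I.loc).append (List.Sublist.refl _)).append ih
    · exact ih.trans (List.sublist_append_right _ _)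

lemma IsFullPlan.feasible_restrict {Q : I.Plan} (hQ : IsFullPlan Q) {s : I.State}
    (hs : s.cart = ∅) (A : Finset (Fin I.n)) :
    I.Feasible s A (restrict Q fun x => decide (x.1 ∈ A ∧ x ∉ s.picked)) := by
  set p : I.Item → Bool := fun x => decide (x.1 ∈ A ∧ x ∉ s.picked) with hp
  have hcap (B : List I.Item) (hB : B ∈ restrict Q p) : (I.ordersOf B).card ≤ w.c := by
    obtain ⟨-, B', hB', rfl⟩ := mem_restrict.1 hB
    exact (Finset.card_le_card (ordersOf_mono List.filter_sublist.subset)).trans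
      (hQ.card_ordersOf_le hB')
  have hne (B : List I.Item) (hB : B ∈ restrict Q p) : B ≠ [] := (mem_restrict.1 hB).1
  refine ⟨flatten_restrict Q p ▸ hQ.nodup.filter _, fun x => ?_, ?_, by simp [hs], by simp [hs],
    ?_, fun B hB => hcap B (List.mem_of_mem_tail hB), fun _ => hne,
    fun B hB => hne B (List.mem_of_mem_tail hB)⟩
  · rw [flatten_restrict, List.mem_filter, hp, decide_eq_true_iff]
    exact and_iff_right (hQ.mem_flatten x)
  · intro B hB x hx y hy hyx
    obtain ⟨-, B', hB', rfl⟩ := mem_restrict.1 hB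
    rw [flatten_restrict, List.mem_filter] at hy
    exact List.mem_filter.2 ⟨hQ.unsplit B' hB' x (List.mem_filter.1 hx).1 y hy.1 hyx, hy.2⟩
  · rw [hs, Finset.empty_union]
    cases hR : restrict Q p with
    | nil => simp [ordersOf]
    | cons B R => exact hcap B (by simp [hR])

lemma exists_last_arrival (hn : 0 < I.n) (hmono : Monotone I.arrival) :
    ∃ j : Fin I.n, (j : ℕ) + 1 = I.n ∧ ∀ k, I.arrival k ≤ I.arrival j :=
  ⟨⟨I.n - 1, by lia⟩, by simp only; lia, fun k => hmono (Fin.le_def.2 (by simp only; lia))⟩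

lemma mem_arrived {τ : ℝ} {j : Fin I.n} : j ∈ I.arrived τ ↔ I.arrival j ≤ τ := by
  simp [arrived]

lemma loc_onAisle (x : I.Item) : w.OnAisle (I.loc x).1 := (I.order x.1).2.2.2 x.2

lemma planLength_eq_zero {sys : PickingSystem} (hloc : ∀ x, I.loc x = w.depot) (P : I.Plan) :
    planLength sys P = 0 := by
  refine walk_eq_zero fun q hq => ?_
  obtain ⟨x | _, -, hq⟩ := List.mem_flatMap.1 hq
  · exact (List.mem_singleton.1 hq).trans (hloc x)
  · cases sys with
    | robot => cases hq
    | _ => exact List.mem_singleton.1 hq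

/-- Every plan for the rest of the instance from state `s` at time `τ` can be extended to a plan
for the whole instance that is completed at least as early. -/
def Extendable (sys : PickingSystem) (s : I.State) (τ : ℝ) : Prop :=
  ∀ P : I.Plan, I.Feasible s Finset.univ P → ∃ Q : I.Plan, IsFullPlan Q ∧
    makespan sys Q ≤ completion sys s.pos τ (I.actions P)

lemma extendable_init (sys : PickingSystem) {τ : ℝ} (hτ : 0 ≤ τ) : Extendable sys I.init τ :=
  fun P hP => ⟨P, hP, completion_mono sys (by simpa [init] using hτ) _⟩

lemma Extendable.move {sys : PickingSystem} {s : I.State} {τ τ' : ℝ} {q : w.Pt}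
    (h : Extendable sys s τ) (hq : τ + w.d s.pos q ≤ τ') :
    Extendable sys ⟨q, s.picked, s.cart⟩ τ' := by
  intro P hP
  obtain ⟨Q, hQ, hle⟩ := h P (hP.congr_pos s.pos)
  exact ⟨Q, hQ, hle.trans (completion_mono sys hq _)⟩

lemma Extendable.pick {sys : PickingSystem} {s : I.State} {τ : ℝ} {x : I.Item}
    (h : Extendable sys s τ) (hx : x ∉ s.picked) (hτ : I.arrival x.1 ≤ τ) :
    Extendable sys (perform sys s (.pick x)) (τ + w.d s.pos (I.loc x)) := by
  intro P hP
  obtain ⟨B, P, rfl⟩ := List.exists_cons_of_ne_nil (hP.continues ⟨x.1, by simp [perform]⟩)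
  obtain ⟨Q, hQ, hle⟩ := h _ ((feasible_pick_iff sys).2 ⟨⟨Finset.mem_univ _, hx⟩, hP⟩)
  rw [actions_cons_cons, completion,
    max_eq_left (hτ.trans (le_add_of_nonneg_right (d_nonneg _ _)))] at hle
  exact ⟨Q, hQ, hle⟩

lemma Extendable.unload {sys : PickingSystem} {s : I.State} {τ : ℝ} (h : Extendable sys s τ)
    (hs : FeasibleBatch s Finset.univ []) :
    Extendable sys (perform sys s .unload)
      (τ + w.d s.pos (target (I := I) sys s.pos .unload)) :=
  fun _ hP => h _ ((feasible_unload_iff sys).2 ⟨hs, hP⟩)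

/-! ### Interventionist reoptimization -/

lemma target_eq_depot {sys : PickingSystem} (hsys : sys ≠ .robot)
    (hloc : ∀ x, I.loc x = w.depot) (p : w.Pt) (α : I.Action) : target sys p α = w.depot := by
  cases α with
  | pick x => exact hloc x
  | unload => cases sys <;> first | rfl | exact absurd rfl hsys

/-- What is preserved while the picker, in state `s` at time `τ`, follows a plan for the orders in
`A`. The last field serves the case in which all items are at the depot. -/
structure RunInvariant (sys : PickingSystem) (A : Finset (Fin I.n)) (s : I.State) (τ : ℝ) :
    Prop where
  arrival_le : ∀ j ∈ A, I.arrival j ≤ τ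
  cart_subset : s.cart ⊆ A
  extendable : Extendable sys s τ
  d_depot_le : w.d w.depot s.pos ≤ τ
  pos_eq_depot : sys ≠ .robot → (∀ x, I.loc x = w.depot) → s.pos = w.depot

namespace RunInvariant

variable {sys : PickingSystem} {A A' : Finset (Fin I.n)} {s : I.State} {τ τ' : ℝ}

lemma move (h : RunInvariant sys A s τ) {q : w.Pt} (hq : τ + w.d s.pos q ≤ τ')
    (hdepot : sys ≠ .robot → (∀ x, I.loc x = w.depot) → q = w.depot) :
    RunInvariant sys A ⟨q, s.picked, s.cart⟩ τ' where
  arrival_le j hj := by linarith [h.arrival_le j hj, d_nonneg s.pos q]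
  cart_subset := h.cart_subset
  extendable := h.extendable.move hq
  d_depot_le := by linarith [h.d_depot_le, d_triangle w.depot s.pos q]
  pos_eq_depot := hdepot

lemma perform {α : I.Action} (h : RunInvariant sys A s τ)
    (hcart : (perform sys s α).cart ⊆ A)
    (hext : Extendable sys (perform sys s α) (τ + w.d s.pos (target sys s.pos α))) :
    RunInvariant sys A (perform sys s α) (τ + w.d s.pos (target sys s.pos α)) where
  arrival_le j hj := by linarith [h.arrival_le j hj, d_nonneg s.pos (target sys s.pos α)]
  cart_subset := hcart
  extendable := hext
  d_depot_le := by
    rw [perform_pos]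
    linarith [h.d_depot_le, d_triangle w.depot s.pos (target sys s.pos α)]
  pos_eq_depot hsys hloc := by rw [perform_pos, target_eq_depot hsys hloc]

lemma mono (h : RunInvariant sys A s τ) (hA : A ⊆ A') (hA' : ∀ j ∈ A', I.arrival j ≤ τ) :
    RunInvariant sys A' s τ :=
  { h with
    arrival_le := hA'
    cart_subset := h.cart_subset.trans hA }

end RunInvariant

lemma RunUntil.runInvariant {sys : PickingSystem} {T τ : ℝ} {s s' : I.State} {l : List I.Action}
    {A : Finset (Fin I.n)} (h : I.RunUntil sys T s τ l s') {P : I.Plan} (hl : l = I.actions P)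
    (hP : I.Feasible s A P) (hs : RunInvariant sys A s τ) (hT : τ ≤ T) :
    RunInvariant sys A s' T := by
  induction h generalizing P with
  | idle s τ => exact hs.move (by simpa using hT) hs.pos_eq_depot
  | @act s s' τ α l hact _ ih =>
    match P with
    | [] => cases hl
    | [] :: P =>
      obtain ⟨rfl, rfl⟩ : α = .unload ∧ l = I.actions P := by simpa using hl
      obtain ⟨hB, hP⟩ := (feasible_unload_iff sys).1 hP
      exact ih rfl hP (hs.perform (Finset.empty_subset A)
        (hs.extendable.unload (hB.mono hs.cart_subset (Finset.subset_univ A)))) hact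
    | (x :: B) :: P =>
      obtain ⟨rfl, rfl⟩ : α = .pick x ∧ l = I.actions (B :: P) := by simpa using hl
      obtain ⟨⟨hxA, hx⟩, hP⟩ := (feasible_pick_iff sys).1 hP
      exact ih rfl hP (hs.perform (Finset.insert_subset hxA hs.cart_subset)
        (hs.extendable.pick hx (hs.arrival_le _ hxA))) hact
  | @walking s τ α l q hwalk hq _ =>
    refine hs.move (by linarith) fun hsys hloc => ?_
    rw [target_eq_depot hsys hloc, hs.pos_eq_depot hsys hloc, d_self] at hwalk
    exact absurd hT (by linarith)

lemma InterventionistResult.exists_last {sys : PickingSystem} {V : ℝ}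
    (h : I.InterventionistResult sys V) (hn : 0 < I.n) (hmono : Monotone I.arrival)
    (hnonneg : ∀ j, 0 ≤ I.arrival j) :
    ∃ (s : I.State) (P : I.Plan) (j : Fin I.n), (∀ k, I.arrival k ≤ I.arrival j) ∧
      RunInvariant sys Finset.univ s (I.arrival j) ∧
      I.OptimalPlan sys s (I.arrival j) Finset.univ P ∧
      V = completion sys s.pos (I.arrival j) (I.actions P) := by
  obtain ⟨-, s, P, hinit, hopt, hrun, hV⟩ := h
  have hinv (m : ℕ) (hm : m < I.n) : RunInvariant sys (I.arrived (I.arrival ⟨m, hm⟩)) (s ⟨m, hm⟩)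
      (I.arrival ⟨m, hm⟩) := by
    induction m with
    | zero =>
      rw [hinit ⟨0, hm⟩ rfl]
      exact ⟨fun _ => mem_arrived.1, Finset.empty_subset _, extendable_init sys (hnonneg _),
        (d_self w.depot).trans_le (hnonneg _), fun _ _ => rfl⟩
    | succ m ih =>
      have hle : I.arrival ⟨m, by lia⟩ ≤ I.arrival ⟨m + 1, hm⟩ := hmono (by simp)
      exact ((hrun ⟨m, by lia⟩ ⟨m + 1, hm⟩ rfl).runInvariant rfl (hopt _).1 (ih _) hle).mono
        (fun j hj => mem_arrived.2 ((mem_arrived.1 hj).trans hle)) fun _ => mem_arrived.1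
  obtain ⟨j, hj, hlast⟩ := exists_last_arrival hn hmono
  have huniv : I.arrived (I.arrival j) = Finset.univ :=
    Finset.eq_univ_iff_forall.2 fun k => mem_arrived.2 (hlast k)
  exact ⟨s j, P j, j, hlast, huniv ▸ hinv j j.2, huniv ▸ hopt j, hV j hj⟩

lemma IsFullPlan.exists_feasible_sublist {Q : I.Plan} (hQ : IsFullPlan Q) (sys : PickingSystem)
    {s : I.State} (hcap : s.cart.card ≤ w.c) {C : List I.Item} (hnd : C.Nodup)
    (hC : ∀ x, x ∈ C ↔ x.1 ∈ s.cart ∧ x ∉ s.picked) :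
    ∃ P : I.Plan, I.Feasible s Finset.univ P ∧
      (route sys (I.actions P)).Sublist
        (C.map I.loc ++ [w.depot] ++ route sys (I.actions Q)) := by
  rcases s.cart.eq_empty_or_nonempty with hs | hs
  · exact ⟨_, hQ.feasible_restrict hs _,
      (route_restrict_sublist _ _ _).trans (List.sublist_append_right _ _)⟩
  · have hcart : s.cart ∪ I.ordersOf C = s.cart := Finset.union_eq_left.2 fun j hj => by
      obtain ⟨x, hx, rfl⟩ := mem_ordersOf.1 hj
      exact ((hC x).1 hx).1
    have hbatch : FeasibleBatch s Finset.univ C :=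
      { nodup := hnd
        remaining := fun x hx => ⟨Finset.mem_univ _, ((hC x).1 hx).2⟩
        unsplit := fun x _ hx => by
          rw [hC, ← hcart]
          tauto
        capacity := by rw [hcart]; exact hcap
        ne_nil := fun h => absurd h hs.ne_empty }
    have hstops : (unloadStops w sys).Sublist [w.depot] := by cases sys <;> simp [unloadStops]
    refine ⟨_, hbatch.feasible_cons (q := w.depot) (hQ.feasible_restrict rfl _), ?_⟩
    rw [route_actions_cons]
    exact ((List.Sublist.refl _).append hstops).append (route_restrict_sublist _ _ _)

lemma OptimalPlan.completion_le {sys : PickingSystem} {s : I.State} {R : ℝ} {P Q : I.Plan}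
    (h : I.OptimalPlan sys s R Finset.univ P) (hR : ∀ k, I.arrival k ≤ R) (hQ : IsFullPlan Q)
    {C : List I.Item} (hnd : C.Nodup) (hC : ∀ x, x ∈ C ↔ x.1 ∈ s.cart ∧ x ∉ s.picked) :
    completion sys s.pos R (I.actions P) ≤
      R + walk s.pos (C.map I.loc ++ [w.depot]) + planLength sys Q := by
  obtain ⟨P', hP', hsub⟩ := hQ.exists_feasible_sublist sys
    ((Finset.card_le_card Finset.subset_union_left).trans h.1.capacity_head) hnd hC
  calc completion sys s.pos R (I.actions P)
      ≤ completion sys s.pos R (I.actions P') := h.2 _ hP'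
    _ = R + walk s.pos (route sys (I.actions P')) := completion_eq_add_walk _ _ fun x _ => hR _
    _ ≤ R + walk s.pos (C.map I.loc ++ [w.depot] ++ route sys (I.actions Q)) := by
        gcongr
        exact walk_le_of_sublist hsub _
    _ = R + walk s.pos (C.map I.loc ++ [w.depot]) + planLength sys Q := by
        rw [walk_append, List.getLastD_concat, add_assoc]

lemma OptimalPlan.completion_le_batchBound {sys : PickingSystem} {s : I.State} {R : ℝ}
    {P Q : I.Plan} (h : I.OptimalPlan sys s R Finset.univ P) (hR : ∀ k, I.arrival k ≤ R)
    (hQ : IsFullPlan Q) :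
    completion sys s.pos R (I.actions P) ≤ R + w.batchBound + planLength sys Q := by
  obtain ⟨C, hC, hlen⟩ := exists_perm_walk_depot_le I.loc
    (Finset.univ.filter fun x : I.Item => x.1 ∈ s.cart ∧ x ∉ s.picked).toList
    fun x _ => loc_onAisle x
  refine (h.completion_le hR hQ (hC.nodup_iff.2 (Finset.nodup_toList _)) fun x => ?_).trans ?_
  · rw [hC.mem_iff, Finset.mem_toList, Finset.mem_filter, and_iff_right (Finset.mem_univ x)]
  · gcongr
    exact hlen _

lemma OptimalPlan.completion_le_three_mul {sys : PickingSystem} {s : I.State} {R : ℝ}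
    {P Q : I.Plan} (h : I.OptimalPlan sys s R Finset.univ P) (hR : ∀ k, I.arrival k ≤ R)
    (hQ : IsFullPlan Q) :
    completion sys s.pos R (I.actions P) ≤
      R + w.d w.depot s.pos + 3 * planLength sys Q := by
  let C := Q.flatten.filter fun x => decide (x.1 ∈ s.cart ∧ x ∉ s.picked)
  have hle := h.completion_le (C := C) hR hQ (hQ.nodup.filter _) fun x => by
    rw [List.mem_filter, decide_eq_true_iff, and_iff_right (hQ.mem_flatten x)]
  have hC : walk w.depot (C.map I.loc) ≤ planLength sys Q := walk_le_of_sublist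
    ((List.filter_sublist.map I.loc).trans (map_loc_flatten_sublist_route sys Q)) _
  have htour : walk s.pos (C.map I.loc ++ [w.depot]) ≤
      w.d w.depot s.pos + walk w.depot (C.map I.loc) + walk w.depot (C.map I.loc) := by
    have hreturn := d_getLastD_le_walk w.depot (C.map I.loc)
    rw [d_comm] at hreturn
    have hle := walk_le_d_add_walk s.pos w.depot (C.map I.loc ++ [w.depot])
    rw [walk_append w.depot, walk_cons, walk_nil, d_comm s.pos] at hle
    linarith
  linarith

/-! ### Non-interventionist reoptimization -/

lemma completion_cons_pcartN (τ : ℝ) (B : List I.Item) (P : I.Plan) :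
    completion .pcartN w.depot τ (I.actions (B :: P)) =
      completion .pcartN w.depot (completion .pcartN w.depot τ (I.batchActions B))
        (I.actions P) := by
  rw [actions_cons, completion_append, route_batchActions]
  simp [unloadStops]

lemma planLength_cons_pcartN (B : List I.Item) (P : I.Plan) :
    planLength .pcartN (B :: P) =
      walk w.depot (route .pcartN (I.batchActions B)) + planLength .pcartN P := by
  rw [planLength, actions_cons, route_append, walk_append, route_batchActions]
  simp [unloadStops]

lemma OptimalPlan.tail {D : Finset I.Item} {A : Finset (Fin I.n)} {B : List I.Item}
    {P : I.Plan} {τ : ℝ} (h : I.OptimalPlan .pcartN ⟨w.depot, D, ∅⟩ τ A (B :: P)) :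
    I.OptimalPlan .pcartN ⟨w.depot, D ∪ B.toFinset, ∅⟩
      (completion .pcartN w.depot τ (I.batchActions B)) A P := by
  refine ⟨h.1.tail _, fun Q hQ => ?_⟩
  have hle := h.2 _ (h.1.head.feasible_cons hQ)
  rwa [completion_cons_pcartN, completion_cons_pcartN] at hle

lemma OptimalPlan.planLength_le {D : Finset I.Item} {A : Finset (Fin I.n)} {P Q : I.Plan} {τ : ℝ}
    (h : I.OptimalPlan .pcartN ⟨w.depot, D, ∅⟩ τ A P) (hA : ∀ j ∈ A, I.arrival j ≤ τ)
    (hQ : I.Feasible ⟨w.depot, D, ∅⟩ A Q) : planLength .pcartN P ≤ planLength .pcartN Q := by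
  have heq {P' : I.Plan} (hP' : I.Feasible ⟨w.depot, D, ∅⟩ A P') :
      completion .pcartN w.depot τ (I.actions P') = τ + planLength .pcartN P' :=
    completion_eq_add_walk _ _ fun x hx => hA _ ((hP'.complete x).1 (pick_mem_actions.1 hx)).1
  have hle := h.2 Q hQ
  rw [heq h.1, heq hQ] at hle
  exact le_of_add_le_add_left hle

lemma OptimalPlan.planLength_le_of_isFullPlan {D : Finset I.Item} {A : Finset (Fin I.n)}
    {P Q : I.Plan} {τ : ℝ} (h : I.OptimalPlan .pcartN ⟨w.depot, D, ∅⟩ τ A P)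
    (hA : ∀ j ∈ A, I.arrival j ≤ τ) (hQ : IsFullPlan Q) :
    planLength .pcartN P ≤ planLength .pcartN Q :=
  (h.planLength_le hA (hQ.feasible_restrict rfl A)).trans
    (walk_le_of_sublist (route_restrict_sublist _ _ _) _)

lemma OptimalPlan.walk_head_le {D : Finset I.Item} {A : Finset (Fin I.n)} {B : List I.Item}
    {P Q : I.Plan} {τ : ℝ} (h : I.OptimalPlan .pcartN ⟨w.depot, D, ∅⟩ τ A (B :: P))
    (hA : ∀ j ∈ A, I.arrival j ≤ τ) (hQ : IsFullPlan Q) :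
    walk w.depot (route .pcartN (I.batchActions B)) ≤
      min (planLength .pcartN Q) w.batchBound := by
  refine le_min ?_ ?_
  · have hle := h.planLength_le_of_isFullPlan hA hQ
    rw [planLength_cons_pcartN] at hle
    exact (le_add_of_nonneg_right (walk_nonneg _ _)).trans hle
  · obtain ⟨B', hB', hlen⟩ := exists_perm_walk_depot_le I.loc B fun x _ => loc_onAisle x
    have hle := h.planLength_le hA ((h.1.head.perm hB').feasible_cons
      (by rw [List.toFinset_eq_of_perm _ _ hB']; exact h.1.tail w.depot))
    rw [planLength_cons_pcartN, planLength_cons_pcartN, add_le_add_iff_right,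
      route_batchActions, route_batchActions] at hle
    exact (route_batchActions _ _).symm ▸ hle.trans (hlen _)

namespace NonInterventionistRun

variable {τ V : ℝ} {A : Finset (Fin I.n)} {D : Finset I.Item} {P : I.Plan}

lemma exists_makespan_le (h : I.NonInterventionistRun τ A D P V)
    (hP : I.Feasible ⟨w.depot, D, ∅⟩ A P) (hext : Extendable .pcartN ⟨w.depot, D, ∅⟩ τ) :
    ∃ Q : I.Plan, IsFullPlan Q ∧ makespan .pcartN Q ≤ V := by
  induction h with
  | replan _ _ hopt _ ih => exact ih hopt.1 hext
  | batch _ _ ih =>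
    refine ih (hP.tail _) fun Q hQ => ?_
    obtain ⟨Q', hQ', hle⟩ := hext _
      ((hP.head.mono (Finset.empty_subset _) (Finset.subset_univ _)).feasible_cons hQ)
    exact ⟨Q', hQ', hle.trans_eq (completion_cons_pcartN _ _ _)⟩
  | wait j hold hj _ _ ih =>
    rw [← hold, mem_arrived, not_le] at hj
    exact ih hP (hext.move (q := w.depot) (by simpa using hj.le))
  | finish _ => exact hext [] hP

lemma le_add_planLength (h : I.NonInterventionistRun τ A D P V) (hA : A = Finset.univ)
    (hτ : ∀ k, I.arrival k ≤ τ) : V ≤ τ + planLength .pcartN P := by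
  induction h with
  | replan _ hnew _ _ _ =>
    exact absurd (hA ▸ Finset.eq_univ_iff_forall.2 fun k => mem_arrived.2 (hτ k)) hnew
  | batch _ _ ih =>
    refine (ih hA fun k => (hτ k).trans (le_completion _ _ _ _)).trans_eq ?_
    rw [completion_eq_add_walk _ _ fun x _ => hτ _, planLength_cons_pcartN, add_assoc]
  | wait j _ hj _ _ _ => exact absurd (hA ▸ Finset.mem_univ j) hj
  | finish _ => exact le_add_of_nonneg_right (walk_nonneg _ _)

/-- As long as some order has not arrived, the picker returns to the depot at most one batch after
the last arrival. -/
lemma le_add_min_add_planLength (h : I.NonInterventionistRun τ A D P V) {R : ℝ} {Q : I.Plan}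
    (hQ : IsFullPlan Q) (hR : ∀ k, I.arrival k ≤ R)
    (hP : I.OptimalPlan .pcartN ⟨w.depot, D, ∅⟩ τ A P) (hA : ∀ j ∈ A, I.arrival j ≤ τ)
    (hA' : A ≠ Finset.univ) (hτ : τ ≤ R + min (planLength .pcartN Q) w.batchBound) :
    V ≤ R + min (planLength .pcartN Q) w.batchBound + planLength .pcartN Q := by
  induction h with
  | @replan τ A D P V P' _ hopt hrun ih =>
    have harr : ∀ j ∈ I.arrived τ, I.arrival j ≤ τ := fun j => mem_arrived.1
    by_cases huniv : I.arrived τ = Finset.univ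
    · have hle := hrun.le_add_planLength huniv fun k => harr k (huniv ▸ Finset.mem_univ k)
      exact hle.trans (add_le_add hτ (hopt.planLength_le_of_isFullPlan harr hQ))
    · exact ih hopt harr huniv hτ
  | @batch τ A D B P V hold _ ih =>
    obtain ⟨j, hj⟩ := not_forall.1 (mt Finset.eq_univ_iff_forall.2 hA')
    rw [← hold, mem_arrived, not_le] at hj
    refine ih hP.tail (fun k hk => (hA k hk).trans (le_completion _ _ _ _)) hA' ?_
    rw [completion_eq_add_walk]
    · exact add_le_add (hj.le.trans (hR j)) (hP.walk_head_le hA hQ)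
    · refine fun x hx => hA _ ((hP.1.complete x).1 (pick_mem_actions.1 ?_)).1
      rw [actions_cons]
      exact List.mem_append_left _ hx
  | @wait τ A D _ j hold hj _ _ ih =>
    have hM : 0 ≤ min (planLength .pcartN Q) w.batchBound :=
      le_min (walk_nonneg _ _) batchBound_nonneg
    have hτj := hj
    rw [← hold, mem_arrived, not_le] at hτj
    exact ih ⟨hP.1, fun _ _ => le_completion _ _ _ _⟩ (fun k hk => (hA k hk).trans hτj.le) hA'
      (by linarith [hR j])
  | finish _ => exact absurd rfl hA'

end NonInterventionistRun

/-! ### Comparison with plans for the whole instance -/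

/-- A completion time `V` compares to the plans for the whole instance if some plan is completed
by the time `V`, and if `V` exceeds the makespan of any plan at most by a bounded factor and at
most by a bounded delay after the last arrival. The last field serves the case in which all items
are at the depot, where a delay cannot be absorbed by a long optimum. -/
structure ComparesToPlans (I : Instance w) (sys : PickingSystem) (V : ℝ) : Prop where
  exists_le : ∃ Q : I.Plan, IsFullPlan Q ∧ makespan sys Q ≤ V
  le_mul : ∀ Q : I.Plan, IsFullPlan Q → V ≤ 5 * makespan sys Q
  le_add : ∀ Q : I.Plan, IsFullPlan Q → ∀ t, (∀ j, I.arrival j ≤ t) →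
    V ≤ makespan sys Q + (t + w.batchBound)
  le_of_depot : sys ≠ .robot → (∀ x, I.loc x = w.depot) →
    ∀ Q : I.Plan, IsFullPlan Q → V ≤ makespan sys Q

lemma InterventionistResult.comparesToPlans {sys : PickingSystem} {V : ℝ}
    (h : I.InterventionistResult sys V) (hn : 0 < I.n) (hmono : Monotone I.arrival)
    (hnonneg : ∀ j, 0 ≤ I.arrival j) : ComparesToPlans I sys V := by
  obtain ⟨s, P, j, hlast, hinv, hopt, rfl⟩ := h.exists_last hn hmono hnonneg
  have hmul {Q : I.Plan} (hQ : IsFullPlan Q) := hopt.completion_le_three_mul hlast hQ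
  refine ⟨hinv.extendable P hopt.1, fun Q hQ => ?_, fun Q hQ t ht => ?_,
    fun hsys hloc Q hQ => ?_⟩
  · linarith [hmul hQ, hinv.d_depot_le, planLength_le_makespan sys Q,
      hQ.arrival_le_makespan sys j]
  · linarith [hopt.completion_le_batchBound hlast hQ, planLength_le_makespan sys Q, ht j]
  · have hle := hmul hQ
    rw [hinv.pos_eq_depot hsys hloc, d_self, planLength_eq_zero hloc] at hle
    rw [hinv.pos_eq_depot hsys hloc]
    linarith [hQ.arrival_le_makespan sys j]

lemma optimalPlan_nil (sys : PickingSystem) (τ : ℝ) : I.OptimalPlan sys I.init τ ∅ [] :=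
  ⟨⟨by simp, by simp, by simp, by simp, by simp [init], by simp [init, ordersOf], by simp, by simp,
    by simp⟩, fun _ _ => le_completion _ _ _ _⟩

lemma NonInterventionistRun.comparesToPlans {V : ℝ} (h : I.NonInterventionistRun 0 ∅ ∅ [] V)
    (hn : 0 < I.n) (hmono : Monotone I.arrival) (hnonneg : ∀ j, 0 ≤ I.arrival j) :
    ComparesToPlans I .pcartN V := by
  obtain ⟨j, -, hlast⟩ := exists_last_arrival hn hmono
  have hV {Q : I.Plan} (hQ : IsFullPlan Q) : V ≤ I.arrival j +
      min (planLength .pcartN Q) w.batchBound + planLength .pcartN Q :=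
    h.le_add_min_add_planLength hQ hlast (optimalPlan_nil _ _) (by simp)
      (fun he => Finset.notMem_empty j (he ▸ Finset.mem_univ j))
      (add_nonneg (hnonneg j) (le_min (walk_nonneg _ _) batchBound_nonneg))
  refine ⟨h.exists_makespan_le (optimalPlan_nil .pcartN 0).1 (extendable_init _ le_rfl),
    fun Q hQ => ?_, fun Q hQ t ht => ?_, fun _ hloc Q hQ => ?_⟩
  · linarith [hV hQ, min_le_left (planLength .pcartN Q) w.batchBound, hnonneg j,
      planLength_le_makespan .pcartN Q, hQ.arrival_le_makespan .pcartN j]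
  · linarith [hV hQ, min_le_right (planLength .pcartN Q) w.batchBound, ht j,
      planLength_le_makespan .pcartN Q]
  · have hle := hV hQ
    rw [planLength_eq_zero hloc, min_eq_left batchBound_nonneg, add_zero, add_zero] at hle
    exact hle.trans (hQ.arrival_le_makespan _ j)

lemma IsReoptResult.comparesToPlans {sys : PickingSystem} {V : ℝ} (h : I.IsReoptResult V sys)
    (hn : 0 < I.n) (hmono : Monotone I.arrival) (hnonneg : ∀ j, 0 ≤ I.arrival j) :
    ComparesToPlans I sys V := by
  cases sys with
  | pcartN => exact NonInterventionistRun.comparesToPlans h hn hmono hnonneg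
  | pcart => exact InterventionistResult.comparesToPlans h hn hmono hnonneg
  | robot => exact InterventionistResult.comparesToPlans h hn hmono hnonneg

/-! ### Far orders -/

/-- An order that forces the picker to walk at least `δ` in every batch that contains it. A robot
may start a batch anywhere, so there two locations of the order have to be apart. -/
def IsFar (sys : PickingSystem) (δ : ℝ) (o : w.CustomerOrder) : Prop :=
  match sys with
  | .robot => ∃ i j, δ ≤ rectDist (o.1.2 i) (o.1.2 j)
  | _ => ∃ i, δ ≤ rectDist w.depot (o.1.2 i)

lemma rectDist_le_walk_of_mem {p q : w.Pt} {l : List w.Pt} (hq : q ∈ l) :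
    rectDist p q ≤ walk p l :=
  calc rectDist p q ≤ walk p [q] := by simpa using rectDist_le_d p q
    _ ≤ walk p l := walk_le_of_sublist (List.singleton_sublist.2 hq) p

lemma rectDist_le_walk_of_mem_of_mem {p q q' : w.Pt} {l : List w.Pt} (hq : q ∈ l)
    (hq' : q' ∈ l) : rectDist q q' ≤ walk p l := by
  induction l generalizing p with
  | nil => cases hq
  | cons r l ih =>
    refine le_trans ?_ (le_add_of_nonneg_left (d_nonneg p r) : walk r l ≤ walk p (r :: l))
    rcases List.mem_cons.1 hq with rfl | hql <;> rcases List.mem_cons.1 hq' with rfl | hql'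
    · simpa [rectDist] using walk_nonneg _ l
    · exact rectDist_le_walk_of_mem hql'
    · exact (rectDist_comm _ _).trans_le (rectDist_le_walk_of_mem hql)
    · exact ih hql hql'

lemma IsFar.le_walk {sys : PickingSystem} {δ : ℝ} {o : w.CustomerOrder} (h : IsFar sys δ o)
    {p : w.Pt} (hp : sys ≠ .robot → p = w.depot) {l : List w.Pt} (hl : ∀ i, o.1.2 i ∈ l) :
    δ ≤ walk p l := by
  cases sys with
  | robot =>
    obtain ⟨i, j, hij⟩ := h
    exact hij.trans (rectDist_le_walk_of_mem_of_mem (hl i) (hl j))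
  | _ =>
    obtain ⟨i, hi⟩ := h
    obtain rfl := hp (by simp)
    exact hi.trans (rectDist_le_walk_of_mem (hl i))

section FarOrders

variable {sys : PickingSystem} {δ : ℝ} {F : Finset (Fin I.n)}

lemma far_card_mul_le_walk_batch (hδ : 0 ≤ δ) (hF : ∀ j ∈ F, IsFar sys δ (I.order j))
    {B : List I.Item} (hfull : ∀ x ∈ B, ∀ y : I.Item, y.1 = x.1 → y ∈ B)
    (hcap : (I.ordersOf B).card ≤ w.c) {p : w.Pt} (hp : sys ≠ .robot → p = w.depot) :
    δ * (F ∩ I.ordersOf B).card ≤ w.c * walk p (B.map I.loc ++ unloadStops w sys) := by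
  have hwalk := walk_nonneg p (B.map I.loc ++ unloadStops w sys)
  rcases (F ∩ I.ordersOf B).eq_empty_or_nonempty with hempty | ⟨j, hj⟩
  · rw [hempty, Finset.card_empty, Nat.cast_zero, mul_zero]
    positivity
  · obtain ⟨hjF, hjB⟩ := Finset.mem_inter.1 hj
    obtain ⟨x, hx, rfl⟩ := mem_ordersOf.1 hjB
    have hle : δ ≤ walk p (B.map I.loc ++ unloadStops w sys) := (hF _ hjF).le_walk hp fun i =>
      List.mem_append_left _ (List.mem_map_of_mem (hfull x hx ⟨x.1, i⟩ rfl))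
    have hcard := (Finset.card_le_card (Finset.inter_subset_right (s₁ := F))).trans hcap
    rw [mul_comm]
    gcongr

lemma far_card_mul_le_walk (hδ : 0 ≤ δ) (hF : ∀ j ∈ F, IsFar sys δ (I.order j)) {P : I.Plan}
    (hfull : ∀ B ∈ P, ∀ x ∈ B, ∀ y : I.Item, y.1 = x.1 → y ∈ B)
    (hcap : ∀ B ∈ P, (I.ordersOf B).card ≤ w.c) {p : w.Pt} (hp : sys ≠ .robot → p = w.depot) :
    δ * (F ∩ I.ordersOf P.flatten).card ≤ w.c * walk p (route sys (I.actions P)) := by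
  induction P generalizing p with
  | nil => simp [ordersOf]
  | cons B P ih =>
    rw [List.forall_mem_cons] at hfull hcap
    have hB := far_card_mul_le_walk_batch hδ hF hfull.1 hcap.1 hp
    have hP := ih hfull.2 hcap.2 (p := (B.map I.loc ++ unloadStops w sys).getLastD p) fun hsys => by
      cases sys <;> simp_all [unloadStops]
    have hunion : F ∩ I.ordersOf (B :: P).flatten =
        F ∩ I.ordersOf B ∪ F ∩ I.ordersOf P.flatten := by
      rw [← Finset.inter_union_distrib_left]
      simp [ordersOf]
    calc δ * (F ∩ I.ordersOf (B :: P).flatten).card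
        ≤ δ * ((F ∩ I.ordersOf B).card + (F ∩ I.ordersOf P.flatten).card) := by
          rw [hunion]
          gcongr
          exact_mod_cast Finset.card_union_le _ _
      _ ≤ w.c * walk p (route sys (I.actions (B :: P))) := by
          rw [route_actions_cons, walk_append, mul_add, mul_add]
          exact add_le_add hB hP

lemma IsFullPlan.far_card_mul_le_makespan {Q : I.Plan} (hQ : IsFullPlan Q) (hδ : 0 ≤ δ)
    (hF : ∀ j ∈ F, IsFar sys δ (I.order j)) : δ * F.card ≤ w.c * makespan sys Q := by
  have hinter : F ∩ I.ordersOf Q.flatten = F := Finset.inter_eq_left.2 fun j _ =>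
    mem_ordersOf.2 ⟨⟨j, ⟨0, (I.order j).2.1⟩⟩, hQ.mem_flatten _, rfl⟩
  calc δ * F.card ≤ w.c * planLength sys Q := by
        rw [← congrArg Finset.card hinter]
        exact far_card_mul_le_walk hδ hF
          (fun B hB x hx y hy => hQ.unsplit B hB x hx y (hQ.mem_flatten y) hy)
          (fun B => hQ.card_ordersOf_le) fun _ => rfl
    _ ≤ w.c * makespan sys Q := by
        gcongr
        exact planLength_le_makespan sys Q

end FarOrders

/-! ### The optimality ratio -/

lemma CIOPT_le_makespan (sys : PickingSystem) {Q : I.Plan} (hQ : IsFullPlan Q) :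
    I.CIOPT sys ≤ makespan sys Q :=
  csInf_le ⟨0, by rintro _ ⟨P, -, rfl⟩; exact le_completion _ _ _ _⟩ ⟨Q, hQ, rfl⟩

namespace ComparesToPlans

variable {sys : PickingSystem} {V : ℝ}

lemma CIOPT_le (h : ComparesToPlans I sys V) : I.CIOPT sys ≤ V :=
  let ⟨_, hQ, hle⟩ := h.exists_le
  (CIOPT_le_makespan sys hQ).trans hle

lemma le_CIOPT (h : ComparesToPlans I sys V) {r : ℝ}
    (hr : ∀ Q : I.Plan, IsFullPlan Q → r ≤ makespan sys Q) : r ≤ I.CIOPT sys := by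
  obtain ⟨Q, hQ, -⟩ := h.exists_le
  exact le_csInf ⟨_, Q, hQ, rfl⟩ (by rintro _ ⟨Q, hQ, rfl⟩; exact hr Q hQ)

lemma CIOPT_pos (h : ComparesToPlans I sys V) {j : Fin I.n} (hj : 0 < I.arrival j) :
    0 < I.CIOPT sys :=
  hj.trans_le (h.le_CIOPT fun _ hQ => hQ.arrival_le_makespan sys j)

lemma le_five_mul_CIOPT (h : ComparesToPlans I sys V) : V ≤ 5 * I.CIOPT sys := by
  have hle := h.le_CIOPT (r := V / 5) fun Q hQ => by linarith [h.le_mul Q hQ]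
  linarith

lemma le_CIOPT_add (h : ComparesToPlans I sys V) {t : ℝ} (ht : ∀ j, I.arrival j ≤ t) :
    V ≤ I.CIOPT sys + (t + w.batchBound) :=
  sub_le_iff_le_add.1 (h.le_CIOPT fun Q hQ => sub_le_iff_le_add.2 (h.le_add Q hQ t ht))

lemma far_card_mul_le_CIOPT (h : ComparesToPlans I sys V) {δ : ℝ} (hδ : 0 ≤ δ)
    {F : Finset (Fin I.n)} (hF : ∀ j ∈ F, IsFar sys δ (I.order j)) :
    δ * F.card ≤ w.c * I.CIOPT sys := by
  have hc : (0 : ℝ) < w.c := Nat.cast_pos.2 w.one_le_c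
  rw [mul_comm (w.c : ℝ), ← div_le_iff₀ hc]
  exact h.le_CIOPT fun Q hQ =>
    (div_le_iff₀' hc).2 (hQ.far_card_mul_le_makespan hδ hF)

end ComparesToPlans

namespace IsReoptResult

variable {sys : PickingSystem} {V : ℝ}

lemma ratio_mem_Icc (h : I.IsReoptResult V sys) (hmono : Monotone I.arrival)
    (hpos : ∀ j, 0 < I.arrival j) : I.ratio sys V ∈ Set.Icc 1 5 := by
  rcases I.n.eq_zero_or_pos with hn | hn
  · simp [ratio, hn]
  · have hV := h.comparesToPlans hn hmono fun j => (hpos j).le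
    have hopt := hV.CIOPT_pos (hpos ⟨0, hn⟩)
    rw [ratio, if_neg hn.ne', Set.mem_Icc, one_le_div₀ hopt, div_le_iff₀ hopt]
    exact ⟨hV.CIOPT_le, hV.le_five_mul_CIOPT⟩

lemma ratio_eq_one_of_depot (h : I.IsReoptResult V sys) (hmono : Monotone I.arrival)
    (hpos : ∀ j, 0 < I.arrival j) (hsys : sys ≠ .robot) (hloc : ∀ x, I.loc x = w.depot) :
    I.ratio sys V = 1 := by
  rcases I.n.eq_zero_or_pos with hn | hn
  · exact if_pos hn
  · have hV := h.comparesToPlans hn hmono fun j => (hpos j).le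
    rw [ratio, if_neg hn.ne', div_eq_one_iff_eq (hV.CIOPT_pos (hpos ⟨0, hn⟩)).ne']
    exact (hV.le_CIOPT (hV.le_of_depot hsys hloc)).antisymm hV.CIOPT_le

lemma ratio_le_one_add_of_isFar (h : I.IsReoptResult V sys) (hmono : Monotone I.arrival)
    (hpos : ∀ j, 0 < I.arrival j) {t : ℝ} (ht : ∀ j, I.arrival j ≤ t) {δ : ℝ} (hδ : 0 < δ)
    {F : Finset (Fin I.n)} (hne : F.Nonempty) (hF : ∀ j ∈ F, IsFar sys δ (I.order j)) :
    I.ratio sys V ≤ 1 + w.c * (t + w.batchBound) / (δ * F.card) := by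
  obtain ⟨j, hj⟩ := hne
  have hV := h.comparesToPlans j.pos hmono fun j => (hpos j).le
  have hopt := hV.CIOPT_pos (hpos j)
  have hK : 0 ≤ t + w.batchBound := add_nonneg ((hpos j).le.trans (ht j)) batchBound_nonneg
  have hcard : 0 < δ * F.card := mul_pos hδ (Nat.cast_pos.2 (Finset.card_pos.2 ⟨j, hj⟩))
  calc I.ratio sys V = V / I.CIOPT sys := if_neg j.pos.ne'
    _ ≤ (I.CIOPT sys + (t + w.batchBound)) / I.CIOPT sys := by
        gcongr
        exact hV.le_CIOPT_add ht
    _ = 1 + (t + w.batchBound) / I.CIOPT sys := by rw [add_div, div_self hopt.ne']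
    _ ≤ 1 + w.c * (t + w.batchBound) / (δ * F.card) := by
        rw [add_le_add_iff_left, div_le_div_iff₀ hopt hcard]
        linarith [mul_le_mul_of_nonneg_left (hV.far_card_mul_le_CIOPT hδ.le hF) hK]

end IsReoptResult

end Instance

/-! ### The orders that arrive in a time window -/

open Warehouse Instance

section Window

variable {X : ℕ → ℝ} {O : ℕ → w.CustomerOrder} {t : ℝ} {sys : PickingSystem} {V : ℝ}

lemma strictMono_arrivalTime (hX : ∀ j, 0 < X j) : StrictMono (arrivalTime X) :=
  strictMono_nat_of_lt_succ fun j =>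
    (lt_add_of_pos_right _ (hX (j + 1))).trans_eq (Finset.sum_range_succ X (j + 1)).symm

lemma arrivalTime_pos (hX : ∀ j, 0 < X j) (j : ℕ) : 0 < arrivalTime X j :=
  Finset.sum_pos (fun i _ => hX i) (by simp)

lemma lt_numArrivals_iff (hX : ∀ j, 0 < X j) (hfin : {j | arrivalTime X j ≤ t}.Finite) {j : ℕ} :
    j < numArrivals X t ↔ arrivalTime X j ≤ t := by
  have hlower : IsLowerSet {j | arrivalTime X j ≤ t} := fun _ _ hle hi =>
    ((strictMono_arrivalTime hX).monotone hle).trans hi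
  rcases hlower.eq_univ_or_Iio with hset | ⟨n, hset⟩
  · exact absurd (hset ▸ hfin) Set.infinite_univ
  · have hn : numArrivals X t = n := by simp [numArrivals, hset]
    rw [hn, ← Set.mem_Iio, ← hset, Set.mem_ofPred_eq]

lemma monotone_arrival_windowInstance (hX : ∀ j, 0 < X j) :
    Monotone (windowInstance X O t).arrival := fun _ _ hij =>
  (strictMono_arrivalTime hX).monotone hij

lemma ratio_windowInstance_mem_Icc (h : (windowInstance X O t).IsReoptResult V sys)
    (hX : ∀ j, 0 < X j) : (windowInstance X O t).ratio sys V ∈ Set.Icc 1 5 :=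
  h.ratio_mem_Icc (monotone_arrival_windowInstance hX) fun j => arrivalTime_pos hX j

lemma ratio_windowInstance_eq_one_of_depot (h : (windowInstance X O t).IsReoptResult V sys)
    (hX : ∀ j, 0 < X j) (hsys : sys ≠ .robot) (hO : ∀ j i, (O j).1.2 i = w.depot) :
    (windowInstance X O t).ratio sys V = 1 :=
  h.ratio_eq_one_of_depot (monotone_arrival_windowInstance hX) (fun j => arrivalTime_pos hX j)
    hsys fun _ => hO _ _

open scoped Classical in
lemma ratio_windowInstance_le_one_add (h : (windowInstance X O t).IsReoptResult V sys)
    (hX : ∀ j, 0 < X j) (hfin : {j | arrivalTime X j ≤ t}.Finite) {δ : ℝ} (hδ : 0 < δ)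
    {m M : ℕ} (hm : arrivalTime X m ≤ t) (hM : 0 < M)
    (hcount : M ≤ Nat.count (fun j => IsFar sys δ (O j)) m) :
    (windowInstance X O t).ratio sys V ≤ 1 + w.c * (t + w.batchBound) / (δ * M) := by
  let farOrders := {j ∈ Finset.range m | IsFar sys δ (O j)}
  have hlt : ∀ j ∈ farOrders, j < (windowInstance X O t).n := fun j hj =>
    (Finset.mem_range.1 (Finset.mem_filter.1 hj).1).trans ((lt_numArrivals_iff hX hfin).2 hm)
  have hcard : M ≤ (farOrders.attachFin hlt).card := by
    rwa [Finset.card_attachFin, ← Nat.count_eq_card_filter_range]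
  have ht : 0 < t := (arrivalTime_pos hX m).trans_le hm
  have hbound := batchBound_nonneg (w := w)
  refine (h.ratio_le_one_add_of_isFar (monotone_arrival_windowInstance hX)
    (fun j => arrivalTime_pos hX j) (fun j => (lt_numArrivals_iff hX hfin).1 j.2) hδ
    (Finset.card_pos.1 (hM.trans_le hcard))
    fun j hj => (Finset.mem_filter.1 (Finset.mem_attachFin hlt |>.1 hj)).2).trans ?_
  gcongr

end Window

/-! ### Far orders have positive probability -/

lemma measurable_rectDist {α : Type*} [MeasurableSpace α] {f g : α → w.Pt} (hf : Measurable f)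
    (hg : Measurable g) : Measurable fun a => rectDist (f a) (g a) := by
  unfold rectDist
  fun_prop

lemma measurableSet_isFar (sys : PickingSystem) (δ : ℝ) :
    MeasurableSet {o : w.CustomerOrder | IsFar sys δ o} := by
  have hrobot : MeasurableSet
      {o : Σ k : ℕ, (Fin k → w.Pt) | ∃ i j, δ ≤ rectDist (o.2 i) (o.2 j)} := by
    refine MeasurableSpace.measurableSet_iInf.2 fun k => ?_
    change MeasurableSet {f : Fin k → w.Pt | ∃ i j, δ ≤ rectDist (f i) (f j)}
    simp only [Set.ofPred_exists]
    exact .iUnion fun i => .iUnion fun j => measurableSet_le measurable_const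
      (measurable_rectDist (measurable_pi_apply i) (measurable_pi_apply j))
  have hcart : MeasurableSet
      {o : Σ k : ℕ, (Fin k → w.Pt) | ∃ i, δ ≤ rectDist w.depot (o.2 i)} := by
    refine MeasurableSpace.measurableSet_iInf.2 fun k => ?_
    change MeasurableSet {f : Fin k → w.Pt | ∃ i, δ ≤ rectDist w.depot (f i)}
    simp only [Set.ofPred_exists]
    exact .iUnion fun i => measurableSet_le measurable_const
      (measurable_rectDist measurable_const (measurable_pi_apply i))
  cases sys with
  | robot => exact measurable_subtype_coe hrobot
  | _ => exact measurable_subtype_coe hcart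

lemma eq_of_forall_not_le_rectDist {p q : w.Pt}
    (h : ∀ m : ℕ, ¬ 1 / ((m : ℝ) + 1) ≤ rectDist p q) : p = q := by
  by_contra hne
  obtain ⟨m, hm⟩ := exists_nat_one_div_lt (rectDist_pos hne)
  exact h m hm.le

lemma exists_isFar_or_ae_depot {sys : PickingSystem} {ν : Measure w.CustomerOrder}
    [IsProbabilityMeasure ν] (hν : sys = .robot → 1 < ∫⁻ o, (CustomerOrder.size o : ℝ≥0∞) ∂ν) :
    (∃ δ : ℝ, 0 < δ ∧ ν {o | IsFar sys δ o} ≠ 0) ∨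
      (sys ≠ .robot ∧ ∀ᵐ o ∂ν, ∀ i, o.1.2 i = w.depot) := by
  refine or_iff_not_imp_left.2 fun hfar => ?_
  push Not at hfar
  have hae : ∀ᵐ o ∂ν, ∀ m : ℕ, ¬ IsFar sys (1 / ((m : ℝ) + 1)) o := ae_all_iff.2 fun m =>
    measure_eq_zero_iff_ae_notMem.1 (hfar _ Nat.one_div_pos_of_nat)
  by_cases hsys : sys = .robot
  · subst hsys
    have hsize : ∀ᵐ o ∂ν, (CustomerOrder.size o : ℝ≥0∞) ≤ 1 := by
      filter_upwards [hae] with o ho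
      have : Subsingleton (Fin o.1.1) := ⟨fun i j =>
        o.2.2.1 (eq_of_forall_not_le_rectDist fun m hm => ho m ⟨i, j, hm⟩)⟩
      exact_mod_cast Fin.subsingleton_iff_le_one.1 this
    have hle := lintegral_mono_ae hsize
    rw [lintegral_one, measure_univ] at hle
    exact absurd (hν rfl) hle.not_gt
  · refine ⟨hsys, ?_⟩
    filter_upwards [hae] with o ho i
    refine (eq_of_forall_not_le_rectDist fun m hm => ho m ?_).symm
    cases sys with
    | robot => exact absurd rfl hsys
    | _ => exact ⟨i, hm⟩

/-! ### Many orders arrive, many of them far -/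

lemma exists_block_forall_not_of_count_lt {p : ℕ → Prop} [DecidablePred p] {M q : ℕ}
    (h : Nat.count p (M * q) < M) :
    ∃ b ∈ Finset.range M, ∀ j ∈ Finset.Ico (b * q) (b * q + q), ¬ p j := by
  induction M with
  | zero => simp at h
  | succ M ih =>
    rw [Nat.succ_mul, Nat.count_add] at h
    by_cases hM : Nat.count p (M * q) < M
    · obtain ⟨b, hb, hnot⟩ := ih hM
      exact ⟨b, Finset.range_subset_range.2 M.le_succ hb, hnot⟩
    · have hzero : Nat.count (fun k => p (M * q + k)) q = 0 := by lia
      refine ⟨M, Finset.self_mem_range_succ M, fun j hj => ?_⟩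
      rw [Finset.mem_Ico] at hj
      simpa [Nat.add_sub_of_le hj.1] using
        Nat.count_iff_forall_not.1 hzero (j - M * q) (by lia)

section Count

variable {Ω E : Type*} [MeasurableSpace Ω] [MeasurableSpace E] {P : Measure Ω} {μ : Measure E}

lemma measure_biInter_preimage_eq_pow {ι : Type*} {Y : ι → Ω → E}
    (hlaw : ∀ j, HasLaw (Y j) μ P) (hindep : iIndepFun Y P) {A : Set E} (hA : MeasurableSet A)
    (s : Finset ι) : P (⋂ j ∈ s, Y j ⁻¹' A) = μ A ^ s.card := by
  rw [hindep.measure_inter_preimage_eq_mul s (sets := fun _ => A) fun _ _ => hA]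
  exact Finset.prod_eq_pow_card fun j _ => (hlaw j).measure_eq hA

open scoped Classical in
lemma measure_count_lt_le {Y : ℕ → Ω → E} (hlaw : ∀ j, HasLaw (Y j) μ P)
    (hindep : iIndepFun Y P) {A : Set E} (hA : MeasurableSet A) (M q : ℕ) :
    P {ω | Nat.count (fun j => Y j ω ∈ A) (M * q) < M} ≤ M * μ Aᶜ ^ q :=
  calc P {ω | Nat.count (fun j => Y j ω ∈ A) (M * q) < M}
      ≤ P (⋃ b ∈ Finset.range M, ⋂ j ∈ Finset.Ico (b * q) (b * q + q), Y j ⁻¹' Aᶜ) := by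
        refine measure_mono fun ω hω => ?_
        simpa only [Set.mem_iUnion, Set.mem_iInter, exists_prop] using!
          exists_block_forall_not_of_count_lt hω
    _ ≤ ∑ b ∈ Finset.range M, P (⋂ j ∈ Finset.Ico (b * q) (b * q + q), Y j ⁻¹' Aᶜ) :=
        measure_biUnion_finset_le _ _
    _ = M * μ Aᶜ ^ q := by
        simp only [measure_biInter_preimage_eq_pow hlaw hindep hA.compl, Nat.card_Ico,
          Nat.add_sub_cancel_left, Finset.sum_const, Finset.card_range, nsmul_eq_mul]

lemma measure_compl_lt_one [IsProbabilityMeasure μ] {A : Set E} (hA : MeasurableSet A)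
    (hμ : μ A ≠ 0) : μ Aᶜ < 1 :=
  (prob_compl_eq_one_sub hA).trans_lt
    (ENNReal.sub_lt_self ENNReal.one_ne_top one_ne_zero hμ)

end Count

lemma integral_le_add_mul_measureReal {Ω : Type*} [MeasurableSpace Ω] {P : Measure Ω}
    [IsProbabilityMeasure P] {f : Ω → ℝ} (hf : Integrable f P) {b C : ℝ}
    (hle : ∀ᵐ ω ∂P, f ω ≤ b + C) : ∫ ω, f ω ∂P ≤ b + C * P.real {ω | b ≤ f ω} := by
  set S := toMeasurable P {ω | b ≤ f ω}
  have hS : MeasurableSet S := measurableSet_toMeasurable _ _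
  have hind : Integrable (S.indicator fun _ => C) P := (integrable_const C).indicator hS
  calc ∫ ω, f ω ∂P ≤ ∫ ω, (b + S.indicator (fun _ => C) ω) ∂P := by
        refine integral_mono_ae hf ((integrable_const b).add hind) ?_
        filter_upwards [hle] with ω hω
        by_cases hmem : ω ∈ S
        · simpa only [Set.indicator_of_mem hmem] using hω
        · rw [Set.indicator_of_notMem hmem, add_zero]
          exact (not_le.1 fun h => hmem (subset_toMeasurable _ _ h)).le
    _ = b + C * P.real {ω | b ≤ f ω} := by
        rw [integral_add (integrable_const b) hind, integral_indicator_const _ hS]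
        simp [S, measureReal_def, measure_toMeasurable, mul_comm]

lemma measure_ratio_eq_zero_of_ae_depot {Ω : Type*} [MeasurableSpace Ω] {P : Measure Ω}
    {ν : Measure w.CustomerOrder} {X : ℕ → Ω → ℝ} {O : ℕ → Ω → w.CustomerOrder} {t : ℝ}
    {sys : PickingSystem} {Reopt : Ω → ℝ}
    (hX_pos : ∀ᵐ ω ∂P, ∀ j, 0 < X j ω) (hO_law : ∀ j, HasLaw (O j) ν P)
    (hReopt : ∀ᵐ ω ∂P, (randomInstance X O t ω).IsReoptResult (Reopt ω) sys)
    (hsys : sys ≠ .robot) (hdepot : ∀ᵐ o ∂ν, ∀ i, o.1.2 i = w.depot) {ε : ℝ} (hε : 0 < ε) :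
    P {ω | 1 + ε ≤ (randomInstance X O t ω).ratio sys (Reopt ω)} = 0 := by
  have hO : ∀ᵐ ω ∂P, ∀ j i, (O j ω).1.2 i = w.depot := ae_all_iff.2 fun j =>
    ae_of_ae_map (hO_law j).aemeasurable ((hO_law j).map_eq ▸ hdepot)
  refine measure_eq_zero_iff_ae_notMem.2 ?_
  filter_upwards [hX_pos, hReopt, hO] with ω hX h hO hω
  have hone := ratio_windowInstance_eq_one_of_depot h hX hsys hO
  exact (hone.trans_lt (lt_add_of_pos_right 1 hε)).not_ge hω

section Families

variable {ι : Type*} {l : Filter ι} {Ω : ι → Type*} [∀ i, MeasurableSpace (Ω i)]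
  {P : ∀ i, Measure (Ω i)}

open scoped Classical in
lemma exists_forall_measure_count_lt_le {E : Type*} [MeasurableSpace E] {μ : Measure E}
    [IsProbabilityMeasure μ] {Y : ∀ i, ℕ → Ω i → E} (hlaw : ∀ i j, HasLaw (Y i j) μ (P i))
    (hindep : ∀ i, iIndepFun (Y i) (P i)) {A : Set E} (hA : MeasurableSet A) (hμ : μ A ≠ 0)
    (M : ℕ) {η : ℝ≥0∞} (hη : 0 < η) :
    ∃ m, ∀ i, P i {ω | Nat.count (fun j => Y i j ω ∈ A) m < M} ≤ η := by
  have hlim : Tendsto (fun q : ℕ => (M : ℝ≥0∞) * μ Aᶜ ^ q) atTop (𝓝 0) := by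
    simpa using ENNReal.Tendsto.const_mul
      (ENNReal.tendsto_pow_atTop_nhds_zero_of_lt_one (measure_compl_lt_one hA hμ))
      (Or.inr (ENNReal.natCast_ne_top M))
  obtain ⟨q, hq⟩ := (hlim.eventually_le_const hη).exists
  exact ⟨M * q, fun i => (measure_count_lt_le (hlaw i) (hindep i) hA M q).trans hq⟩

lemma tendsto_measure_lt_arrivalTime {X : ∀ i, ℕ → Ω i → ℝ}
    (hX : ∀ j, ∀ s > 0, Tendsto (fun i => P i {ω | s < X i j ω}) l (𝓝 0)) {t : ℝ} (ht : 0 < t)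
    (m : ℕ) : Tendsto (fun i => P i {ω | t < arrivalTime (fun j => X i j ω) m}) l (𝓝 0) := by
  have hsum : Tendsto (fun i => ∑ j ∈ Finset.range (m + 1), P i {ω | t / (m + 1) < X i j ω}) l
      (𝓝 0) := by
    simpa using tendsto_finsetSum (Finset.range (m + 1)) fun j _ =>
      hX j (t / (m + 1)) (by positivity)
  refine tendsto_of_tendsto_of_tendsto_of_le_of_le tendsto_const_nhds hsum (fun _ => zero_le) ?_
  refine fun i => (measure_mono fun ω hω => ?_).trans (measure_biUnion_finset_le _ _)
  by_contra hnot
  simp only [Set.mem_iUnion, Set.mem_ofPred_eq, exists_prop, not_exists, not_and, not_lt] at hnot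
  have hle := Finset.sum_le_card_nsmul _ (fun j => X i j ω) _ hnot
  rw [Finset.card_range, nsmul_eq_mul, Nat.cast_succ, mul_div_cancel₀ _ (by positivity)] at hle
  exact hle.not_gt hω

lemma tendsto_integral_of_tendsto_measure [∀ i, IsProbabilityMeasure (P i)]
    {f : ∀ i, Ω i → ℝ} {a C : ℝ} (hf : ∀ i, Integrable (f i) (P i))
    (hmem : ∀ i, ∀ᵐ ω ∂P i, f i ω ∈ Set.Icc a C)
    (h : ∀ ε : ℝ, 0 < ε → Tendsto (fun i => P i {ω | a + ε ≤ f i ω}) l (𝓝 0)) :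
    Tendsto (fun i => ∫ ω, f i ω ∂P i) l (𝓝 a) := by
  refine tendsto_order.2 ⟨fun b hb => .of_forall fun i => hb.trans_le ?_, fun b hb => ?_⟩
  · simpa using integral_mono_ae (integrable_const a) (hf i) ((hmem i).mono fun _ hω => hω.1)
  · obtain ⟨ε, hε, hεb⟩ : ∃ ε > 0, a + ε < b := ⟨(b - a) / 2, by linarith, by linarith⟩
    have hbound : Tendsto (fun i => a + ε + (C - a) * (P i).real {ω | a + ε ≤ f i ω}) l
        (𝓝 (a + ε)) := by
      simpa [measureReal_def] using
        (((ENNReal.tendsto_toReal ENNReal.zero_ne_top).comp (h ε hε)).const_mul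
          (C - a)).const_add (a + ε)
    filter_upwards [hbound.eventually_lt_const hεb] with i hi
    exact (integral_le_add_mul_measureReal (hf i)
      ((hmem i).mono fun ω hω => by linarith [hω.2])).trans_lt hi

lemma tendsto_measure_ratio_of_isFar {ν : Measure w.CustomerOrder} [IsProbabilityMeasure ν]
    {X : ∀ i, ℕ → Ω i → ℝ} {O : ∀ i, ℕ → Ω i → w.CustomerOrder} {t : ℝ} (ht : 0 < t)
    {sys : PickingSystem} {Reopt : ∀ i, Ω i → ℝ}
    (hX_pos : ∀ i, ∀ᵐ ω ∂P i, ∀ j, 0 < X i j ω)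
    (hX_tendsto : ∀ j, ∀ s > 0, Tendsto (fun i => P i {ω | s < X i j ω}) l (𝓝 0))
    (hfin : ∀ i, ∀ᵐ ω ∂P i, {j | arrivalTime (fun j => X i j ω) j ≤ t}.Finite)
    (hO_law : ∀ i j, HasLaw (O i j) ν (P i)) (hO_indep : ∀ i, iIndepFun (O i) (P i))
    (hReopt : ∀ i, ∀ᵐ ω ∂P i, (randomInstance (X i) (O i) t ω).IsReoptResult (Reopt i ω) sys)
    {δ : ℝ} (hδ : 0 < δ) (hfar : ν {o | IsFar sys δ o} ≠ 0) {ε : ℝ} (hε : 0 < ε) :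
    Tendsto (fun i => P i {ω | 1 + ε ≤ (randomInstance (X i) (O i) t ω).ratio sys (Reopt i ω)})
      l (𝓝 0) := by
  classical
  obtain ⟨M, hM, hMε⟩ : ∃ M : ℕ, 0 < M ∧ w.c * (t + w.batchBound) / (δ * M) < ε := by
    have hlim := (tendsto_natCast_atTop_atTop (R := ℝ)).const_mul_atTop hδ
    exact ((eventually_gt_atTop 0).and
      ((hlim.const_div_atTop (w.c * (t + w.batchBound))).eventually_lt_const hε)).exists
  refine ENNReal.tendsto_nhds_zero.2 fun η hη => ?_
  have hη' : 0 < η / 2 := ENNReal.half_pos hη.ne'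
  obtain ⟨m, hm⟩ := exists_forall_measure_count_lt_le hO_law hO_indep
    (measurableSet_isFar sys δ) hfar M hη'
  filter_upwards [(tendsto_measure_lt_arrivalTime hX_tendsto ht m).eventually_le_const hη']
    with i hi
  calc P i {ω | 1 + ε ≤ (randomInstance (X i) (O i) t ω).ratio sys (Reopt i ω)}
      ≤ P i ({ω | t < arrivalTime (fun j => X i j ω) m} ∪
          {ω | Nat.count (fun j => O i j ω ∈ {o | IsFar sys δ o}) m < M}) := by
        refine measure_mono_ae ?_
        filter_upwards [hX_pos i, hfin i, hReopt i] with ω hX hfin h hω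
        by_contra hnot
        obtain ⟨harrival, hcount⟩ := not_or.1 hnot
        have hle := ratio_windowInstance_le_one_add h hX hfin hδ (not_lt.1 harrival) hM
          (not_lt.1 hcount)
        exact (hle.trans_lt (add_lt_add_right hMε 1)).not_ge hω
    _ ≤ η / 2 + η / 2 := (measure_union_le _ _).trans (add_le_add hi (hm i))
    _ = η := ENNReal.add_halves η

end Families

/-! ### Exponential interarrival times -/

lemma expMeasure_Ioi {r : ℝ} (hr : 0 < r) {s : ℝ} (hs : 0 ≤ s) :
    expMeasure r (Set.Ioi s) = ENNReal.ofReal (Real.exp (-(r * s))) := by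
  have := isProbabilityMeasure_expMeasure hr
  have hIic : (expMeasure r).real (Set.Iic s) = 1 - Real.exp (-(r * s)) := by
    rw [← cdf_eq_real, cdf_expMeasure_eq hr, if_pos hs]
  rw [← Set.compl_Iic, ← ofReal_measureReal, probReal_compl_eq_one_sub measurableSet_Iic, hIic,
    sub_sub_cancel]

namespace PoissonModel

variable {Ω : Type*} [MeasurableSpace Ω] {P : Measure Ω} {lam : ℝ} {ν : Measure w.CustomerOrder}
  {X : ℕ → Ω → ℝ} {O : ℕ → Ω → w.CustomerOrder}

lemma hasLaw_X (h : PoissonModel P lam ν X O) (j : ℕ) : HasLaw (X j) (expMeasure lam) P :=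
  ⟨(h.measurable_X j).aemeasurable, h.law_X j⟩

lemma hasLaw_O (h : PoissonModel P lam ν X O) (j : ℕ) : HasLaw (O j) ν P :=
  ⟨(h.measurable_O j).aemeasurable, h.law_O j⟩

lemma measure_lt (h : PoissonModel P lam ν X O) (hlam : 0 < lam) (j : ℕ) {s : ℝ} (hs : 0 ≤ s) :
    P {ω | s < X j ω} = ENNReal.ofReal (Real.exp (-(lam * s))) :=
  ((h.hasLaw_X j).measure_eq measurableSet_Ioi).trans (expMeasure_Ioi hlam hs)

lemma ae_pos [IsProbabilityMeasure P] (h : PoissonModel P lam ν X O) (hlam : 0 < lam) :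
    ∀ᵐ ω ∂P, ∀ j, 0 < X j ω := ae_all_iff.2 fun j =>
  (mem_ae_iff_prob_eq_one (measurableSet_lt measurable_const (h.measurable_X j))).2 <| by
    simpa using h.measure_lt hlam j le_rfl

lemma ae_exists_lt (h : PoissonModel P lam ν X O) (hlam : 0 < lam) {t : ℝ} (ht : 0 ≤ t) :
    ∀ᵐ ω ∂P, ∃ j, t < X j ω := by
  have := isProbabilityMeasure_expMeasure hlam
  have hlim := ENNReal.tendsto_pow_atTop_nhds_zero_of_lt_one <|
    measure_compl_lt_one (μ := expMeasure lam) (measurableSet_Ioi (a := t)) <| by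
      rw [expMeasure_Ioi hlam ht]
      exact (ENNReal.ofReal_pos.2 (Real.exp_pos _)).ne'
  refine le_antisymm (ge_of_tendsto' hlim fun q => ?_) zero_le
  calc P {ω | ¬ ∃ j, t < X j ω} ≤ P (⋂ j ∈ Finset.range q, X j ⁻¹' (Set.Ioi t)ᶜ) :=
        measure_mono fun ω hω => Set.mem_iInter₂.2 fun j _ hj => hω ⟨j, hj⟩
    _ = expMeasure lam (Set.Ioi t)ᶜ ^ q := by
        rw [measure_biInter_preimage_eq_pow h.hasLaw_X h.indep_X measurableSet_Ioi.compl,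
          Finset.card_range]

lemma ae_finite_arrivals [IsProbabilityMeasure P] (h : PoissonModel P lam ν X O) (hlam : 0 < lam)
    {t : ℝ} (ht : 0 ≤ t) : ∀ᵐ ω ∂P, {j | arrivalTime (fun j => X j ω) j ≤ t}.Finite := by
  filter_upwards [h.ae_pos hlam, h.ae_exists_lt hlam ht] with ω hX ⟨k, hk⟩
  refine (Set.finite_Iio k).subset fun j hj => Set.mem_Iio.2 (lt_of_not_ge fun hkj => ?_)
  have hle : X k ω ≤ arrivalTime (fun j => X j ω) j :=
    Finset.single_le_sum (f := fun j => X j ω) (fun i _ => (hX i).le)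
      (Finset.mem_range.2 (Nat.lt_succ_of_le hkj))
  exact (hk.trans_le hle).not_ge hj

lemma tendsto_measure_lt {ι : Type*} {l : Filter ι} {Ω : ι → Type*} [∀ i, MeasurableSpace (Ω i)]
    {P : ∀ i, Measure (Ω i)} {lam : ι → ℝ} {X : ∀ i, ℕ → Ω i → ℝ}
    {O : ∀ i, ℕ → Ω i → w.CustomerOrder} (h : ∀ i, PoissonModel (P i) (lam i) ν (X i) (O i))
    (hlam_pos : ∀ i, 0 < lam i) (hlam : Tendsto lam l atTop) (j : ℕ) {s : ℝ} (hs : 0 < s) :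
    Tendsto (fun i => P i {ω | s < X i j ω}) l (𝓝 0) := by
  simp only [(h _).measure_lt (hlam_pos _) j hs.le]
  simpa using ENNReal.tendsto_ofReal
    (Real.tendsto_exp_neg_atTop_nhds_zero.comp (hlam.atTop_mul_const hs))

end PoissonModel

end OOBSRP

end

theorem theorem3_general {w : OOBSRP.Warehouse} {sys : OOBSRP.PickingSystem}
    {ν : Measure w.CustomerOrder} [IsProbabilityMeasure ν]
    (hν : sys = OOBSRP.PickingSystem.robot →
      1 < ∫⁻ o, (OOBSRP.Warehouse.CustomerOrder.size o : ℝ≥0∞) ∂ν)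
    {t : ℝ} (ht : 0 < t) {ι : Type*} {l : Filter ι} {Ω : ι → Type*}
    [∀ i, MeasurableSpace (Ω i)] {P : ∀ i, Measure (Ω i)} [∀ i, IsProbabilityMeasure (P i)]
    {X : ∀ i, ℕ → Ω i → ℝ} {O : ∀ i, ℕ → Ω i → w.CustomerOrder}
    (hX_pos : ∀ i, ∀ᵐ ω ∂P i, ∀ j, 0 < X i j ω)
    (hX_tendsto : ∀ j, ∀ s > 0, Tendsto (fun i => P i {ω | s < X i j ω}) l (𝓝 0))
    (hfin : ∀ i, ∀ᵐ ω ∂P i, {j | OOBSRP.arrivalTime (fun j => X i j ω) j ≤ t}.Finite)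
    (hO_law : ∀ i j, HasLaw (O i j) ν (P i)) (hO_indep : ∀ i, iIndepFun (O i) (P i))
    {Reopt : ∀ i, Ω i → ℝ}
    (hReopt : ∀ i, ∀ᵐ ω ∂P i,
      (OOBSRP.randomInstance (X i) (O i) t ω).IsReoptResult (Reopt i ω) sys)
    (hmeas : ∀ i, AEMeasurable
      (fun ω => (OOBSRP.randomInstance (X i) (O i) t ω).ratio sys (Reopt i ω)) (P i)) :
    (∀ i, Integrable
      (fun ω => (OOBSRP.randomInstance (X i) (O i) t ω).ratio sys (Reopt i ω)) (P i)) ∧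
    Tendsto (fun i => ∫ ω, (OOBSRP.randomInstance (X i) (O i) t ω).ratio sys (Reopt i ω) ∂P i)
      l (𝓝 1) ∧
    ∀ ε : ℝ, 0 < ε →
      Tendsto
        (fun i => P i {ω | 1 + ε ≤ (OOBSRP.randomInstance (X i) (O i) t ω).ratio sys (Reopt i ω)})
        l (𝓝 0) := by
  have hmem : ∀ i, ∀ᵐ ω ∂P i,
      (OOBSRP.randomInstance (X i) (O i) t ω).ratio sys (Reopt i ω) ∈ Set.Icc 1 5 := fun i => by
    filter_upwards [hX_pos i, hReopt i] with ω hX h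
    exact OOBSRP.ratio_windowInstance_mem_Icc h hX
  have hint := fun i => Integrable.of_mem_Icc 1 5 (hmeas i) (hmem i)
  have hprob : ∀ ε : ℝ, 0 < ε → Tendsto
      (fun i => P i {ω | 1 + ε ≤ (OOBSRP.randomInstance (X i) (O i) t ω).ratio sys (Reopt i ω)})
      l (𝓝 0) := fun ε hε => by
    rcases OOBSRP.exists_isFar_or_ae_depot hν with ⟨δ, hδ, hfar⟩ | ⟨hsys, hdepot⟩
    · exact OOBSRP.tendsto_measure_ratio_of_isFar ht hX_pos hX_tendsto hfin hO_law hO_indep hReopt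
        hδ hfar hε
    · exact tendsto_const_nhds.congr fun i => (OOBSRP.measure_ratio_eq_zero_of_ae_depot (hX_pos i)
        (hO_law i) (hReopt i) hsys hdepot hε).symm
  exact ⟨hint, OOBSRP.tendsto_integral_of_tendsto_measure hint hmem hprob, hprob⟩

theorem theorem3 (w : OOBSRP.Warehouse) (sys : OOBSRP.PickingSystem)
    (ν : Measure w.CustomerOrder) [IsProbabilityMeasure ν]
    (hν : sys = OOBSRP.PickingSystem.robot →
      1 < ∫⁻ o, (OOBSRP.Warehouse.CustomerOrder.size o : ℝ≥0∞) ∂ν)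
    (t : ℝ) (ht : 0 < t)
    (lam : ℕ → ℝ) (hlam_pos : ∀ i, 0 < lam i) (hlam_mono : Monotone lam)
    (hlam : Tendsto lam atTop atTop)
    {Ω : ℕ → Type*} [∀ i, MeasurableSpace (Ω i)]
    (P : ∀ i, Measure (Ω i)) [∀ i, IsProbabilityMeasure (P i)]
    (X : ∀ i, ℕ → Ω i → ℝ) (O : ∀ i, ℕ → Ω i → w.CustomerOrder)
    (hmodel : ∀ i, OOBSRP.PoissonModel (P i) (lam i) ν (X i) (O i))
    (Reopt : ∀ i, Ω i → ℝ)
    (hReopt : ∀ i, ∀ᵐ ω ∂P i,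
      (OOBSRP.randomInstance (X i) (O i) t ω).IsReoptResult (Reopt i ω) sys)
    (hmeas : ∀ i, AEMeasurable
      (fun ω => (OOBSRP.randomInstance (X i) (O i) t ω).ratio sys (Reopt i ω)) (P i)) :
    (∀ i, Integrable
      (fun ω => (OOBSRP.randomInstance (X i) (O i) t ω).ratio sys (Reopt i ω)) (P i)) ∧
    Tendsto (fun i => ∫ ω, (OOBSRP.randomInstance (X i) (O i) t ω).ratio sys (Reopt i ω) ∂P i)
      atTop (𝓝 1) ∧
    ∀ ε : ℝ, 0 < ε →
      Tendsto
        (fun i => P i {ω | 1 + ε ≤ (OOBSRP.randomInstance (X i) (O i) t ω).ratio sys (Reopt i ω)})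
        atTop (𝓝 0) :=
  theorem3_general hν ht (fun i => (hmodel i).ae_pos (hlam_pos i))
    (fun j _ => OOBSRP.PoissonModel.tendsto_measure_lt hmodel hlam_pos hlam j)
    (fun i => (hmodel i).ae_finite_arrivals (hlam_pos i) ht.le) (fun i => (hmodel i).hasLaw_O)
    (fun i => (hmodel i).indep_O) hReopt hmeas
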